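/- Let $\Bbbk$ be an algebraically closed field of characteristic zero and let $L=L_0\oplus L_1$ be a finite-dimensional Lie superalgebra over $\Bbbk$, that is, a finite-dimensional $\mathbb Z/2$-graded $\Bbbk$-vector space with a bilinear bracket such that, for homogeneous $x,y,z$ of degrees $|x|,|y|,|z|$, one has $[L_\alpha,L_\beta]\subseteq L_{\alpha+\beta}$, $[x,y]=-(-1)^{|x||y|}[y,x]$, and $$(-1)^{|x||z|}[x,[y,z]]+(-1)^{|y||x|}[y,[z,x]]+(-1)^{|z||y|}[z,[x,y]]=0 .$$ Let $U(L)$ be its universal enveloping algebra, the quotient of the tensor algebra $T(L)$ by the two-sided ideal generated by all $x\otimes y-(-1)^{|x||y|}y\otimes x-[x,y]$ with $x,y\in L$ homogeneous, and let $\mathcal F=(F_n)_{n\ge 0}$ be its PBW filtration: $F_n$ is the span of all products of at most $n$ elements of $L$. **Theorem.** $U(L)$ is congenial with respect to the PBW filtration $\mathcal F$. Here a $\Bbbk$-algebra $A$ with an $\mathbb N$-filtration $\mathcal F$ (an increasing exhaustive chain of subspaces $F_n$ with $1\in F_0$ and $F_iF_j\subseteq F_{i+j}$) is called congenial if the following hold.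 1. $\mathcal F$ is locally finite: every $F_n$ is finite-dimensional over $\Bbbk$. 2. There are a finitely generated subring $D\subseteq\Bbbk$ and a $D$-subalgebra $A_D\subseteq A$ which is an order of $A$, that is, $A_D$ is free as a $D$-module and the natural map $A_D\otimes_D\Bbbk\to A$ is bijective; and the induced filtration $(A_D\cap F_n)_n$ is locally finite: every $A_D\cap F_n$ is a finitely generated $D$-module. 3. For the same $D$ and $A_D$, the associated graded ring $\operatorname{gr}_{\mathcal F}A_D$ of the induced filtration is, via the natural map $\operatorname{gr}_{\mathcal F}A_D\to\operatorname{gr}_{\mathcal F}A$, an order of $\operatorname{gr}_{\mathcal F}A$: this map is injective, $\operatorname{gr}_{\mathcal F}A_D$ is free over $D$, and $\operatorname{gr}_{\mathcal F}A_D\otimes_D\Bbbk\to\operatorname{gr}_{\mathcal F}A$ is bijective. 4. $\operatorname{gr}_{\mathcal F}A_D$ is strongly noetherian over $D$, that is, $(\operatorname{gr}_{\mathcal F}A_D)\otimes_D C$ is (left and right) noetherian for every commutative noetherian $D$-algebra $C$; and each of its graded pieces is a finitely generated $D$-module. 5. For every factor ring $F$ of $D$ that is a finite field, $A_D\otimes_D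 F$ is a finitely generated, (left and right) noetherian $F$-algebra that satisfies a nonzero polynomial identity over $F$. -/

import Mathlib

open scoped TensorProduct DirectSum

universe u v w

noncomputable section

/-! ### Filtered algebras and their associated graded algebras -/

/-- An `ℕ`-filtration of an associative `R`-algebra `A`: an increasing exhaustive chain of
`R`-submodules `F 0 ≤ F 1 ≤ ...` with `1 ∈ F 0` and `F i * F j ⊆ F (i + j)`. -/
structure AlgFiltration (R : Type u) (A : Type v) [CommRing R] [Ring A] [Algebra R A] where
  F : ℕ → Submodule R A
  mono : Monotone F
  one_mem : (1 : A) ∈ F 0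
  mul_mem : ∀ {i j : ℕ} {a b : A}, a ∈ F i → b ∈ F j → a * b ∈ F (i + j)
  exhaustive : ∀ a : A, ∃ n, a ∈ F n

namespace AlgFiltration

section Gr

variable {R : Type u} {A : Type v} [CommRing R] [Ring A] [Algebra R A] (𝓕 : AlgFiltration R A)

/-- The previous step `F (n - 1)` of the filtration, where `F (-1) = 0`. -/
def prev : ℕ → Submodule R A
  | 0 => ⊥
  | n + 1 => 𝓕.F n

lemma prev_le (n : ℕ) : 𝓕.prev n ≤ 𝓕.F n := by
  cases n with
  | zero => exact bot_le
  | succ n => exact 𝓕.mono (Nat.le_succ n)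

lemma prev_mul_mem {i j : ℕ} {a b : A} (ha : a ∈ 𝓕.prev i) (hb : b ∈ 𝓕.F j) :
    a * b ∈ 𝓕.prev (i + j) := by
  cases i with
  | zero =>
    have h0 : a = 0 := (Submodule.mem_bot R).1 ha
    rw [h0, zero_mul]
    exact zero_mem _
  | succ i =>
    have h1 : a * b ∈ 𝓕.F (i + j) := 𝓕.mul_mem ha hb
    rw [show i + 1 + j = i + j + 1 by omega]
    exact h1

lemma mul_prev_mem {i j : ℕ} {a b : A} (ha : a ∈ 𝓕.F i) (hb : b ∈ 𝓕.prev j) :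
    a * b ∈ 𝓕.prev (i + j) := by
  cases j with
  | zero =>
    have h0 : b = 0 := (Submodule.mem_bot R).1 hb
    rw [h0, mul_zero]
    exact zero_mem _
  | succ j => exact 𝓕.mul_mem ha hb

/-- The degree `n` piece `F n / F (n - 1)` of the associated graded algebra. -/
def GrPiece (n : ℕ) : Type v := 𝓕.F n ⧸ (𝓕.prev n).submoduleOf (𝓕.F n)

instance (n : ℕ) : AddCommGroup (𝓕.GrPiece n) :=
  inferInstanceAs (AddCommGroup (𝓕.F n ⧸ (𝓕.prev n).submoduleOf (𝓕.F n)))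

instance (n : ℕ) : Module R (𝓕.GrPiece n) :=
  inferInstanceAs (Module R (𝓕.F n ⧸ (𝓕.prev n).submoduleOf (𝓕.F n)))

/-- The class of `a ∈ F n` in `F n / F (n - 1)`. -/
def symbol (n : ℕ) (a : A) (ha : a ∈ 𝓕.F n) : 𝓕.GrPiece n :=
  (Submodule.Quotient.mk ⟨a, ha⟩ : 𝓕.F n ⧸ (𝓕.prev n).submoduleOf (𝓕.F n))

lemma symbol_surjective {n : ℕ} (x : 𝓕.GrPiece n) : ∃ a ha, x = 𝓕.symbol n a ha := by
  obtain ⟨⟨a, ha⟩, rfl⟩ := Submodule.Quotient.mk_surjective _ x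
  exact ⟨a, ha, rfl⟩

lemma symbol_eq_zero {n : ℕ} {a : A} {ha : a ∈ 𝓕.F n} :
    𝓕.symbol n a ha = 0 ↔ a ∈ 𝓕.prev n := by
  exact Submodule.Quotient.mk_eq_zero _

lemma symbol_congr {n : ℕ} {a b : A} (h : a = b) (ha : a ∈ 𝓕.F n) (hb : b ∈ 𝓕.F n) :
    𝓕.symbol n a ha = 𝓕.symbol n b hb := by
  subst h
  rfl

/-- A linear map on `F n` which vanishes on `F (n - 1)` descends to `F n / F (n - 1)`. -/
def grPieceLift {M : Type*} [AddCommGroup M] [Module R M] (n : ℕ) (g : 𝓕.F n →ₗ[R] M)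
    (hg : ∀ b : 𝓕.F n, (b : A) ∈ 𝓕.prev n → g b = 0) : 𝓕.GrPiece n →ₗ[R] M :=
  Submodule.liftQ ((𝓕.prev n).submoduleOf (𝓕.F n)) g (fun b hb => hg b hb)

/-- Left multiplication by `a ∈ F i`, as a map `F j → F (i + j)`. -/
def mulLeftPiece (i j : ℕ) (a : 𝓕.F i) : 𝓕.F j →ₗ[R] 𝓕.F (i + j) :=
  ((LinearMap.mulLeft R (a : A)).comp (𝓕.F j).subtype).codRestrict (𝓕.F (i + j))
    (fun b => 𝓕.mul_mem a.2 b.2)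

/-- The product `F i / F (i - 1) × F j / F (j - 1) → F (i + j) / F (i + j - 1)` induced by the
product of `A`. -/
def grMul (i j : ℕ) : 𝓕.GrPiece i →ₗ[R] 𝓕.GrPiece j →ₗ[R] 𝓕.GrPiece (i + j) :=
  Submodule.liftQ _
    { toFun := fun a => Submodule.mapQ _ _ (𝓕.mulLeftPiece i j a)
        (fun b hb => 𝓕.mul_prev_mem a.2 hb)
      map_add' := fun a a' => by
        refine Submodule.linearMap_qext _ (LinearMap.ext fun b => ?_)
        exact congrArg Submodule.Quotient.mk (Subtype.ext (add_mul (a : A) a' b))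
      map_smul' := fun r a => by
        refine Submodule.linearMap_qext _ (LinearMap.ext fun b => ?_)
        exact congrArg Submodule.Quotient.mk (Subtype.ext (smul_mul_assoc r (a : A) b)) }
    (fun a ha => by
      refine LinearMap.mem_ker.2 (Submodule.linearMap_qext _ (LinearMap.ext fun b => ?_))
      exact (Submodule.Quotient.mk_eq_zero _).2 (𝓕.prev_mul_mem ha b.2))

lemma grMul_symbol {i j : ℕ} {a b : A} (ha : a ∈ 𝓕.F i) (hb : b ∈ 𝓕.F j) :
    𝓕.grMul i j (𝓕.symbol i a ha) (𝓕.symbol j b hb) =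
      𝓕.symbol (i + j) (a * b) (𝓕.mul_mem ha hb) := rfl

lemma mk_symbol_eq {i j : ℕ} (hij : i = j) {a b : A} (hab : a = b) (ha : a ∈ 𝓕.F i)
    (hb : b ∈ 𝓕.F j) :
    GradedMonoid.mk (A := 𝓕.GrPiece) i (𝓕.symbol i a ha) = GradedMonoid.mk j (𝓕.symbol j b hb) := by
  subst hij
  subst hab
  rfl

instance grGOne : GradedMonoid.GOne 𝓕.GrPiece where
  one := 𝓕.symbol 0 1 𝓕.one_mem

instance grGMul : GradedMonoid.GMul 𝓕.GrPiece where
  mul {i j} x y := 𝓕.grMul i j x y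

instance grGMonoid : GradedMonoid.GMonoid 𝓕.GrPiece where
  one_mul := by
    rintro ⟨i, x⟩
    obtain ⟨a, ha, rfl⟩ := 𝓕.symbol_surjective x
    exact 𝓕.mk_symbol_eq (zero_add i) (one_mul a) (𝓕.mul_mem 𝓕.one_mem ha) ha
  mul_one := by
    rintro ⟨i, x⟩
    obtain ⟨a, ha, rfl⟩ := 𝓕.symbol_surjective x
    exact 𝓕.mk_symbol_eq (add_zero i) (mul_one a) (𝓕.mul_mem ha 𝓕.one_mem) ha
  mul_assoc := by
    rintro ⟨i, x⟩ ⟨j, y⟩ ⟨l, z⟩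
    obtain ⟨a, ha, rfl⟩ := 𝓕.symbol_surjective x
    obtain ⟨b, hb, rfl⟩ := 𝓕.symbol_surjective y
    obtain ⟨c, hc, rfl⟩ := 𝓕.symbol_surjective z
    exact 𝓕.mk_symbol_eq (add_assoc i j l) (mul_assoc a b c)
      (𝓕.mul_mem (𝓕.mul_mem ha hb) hc) (𝓕.mul_mem ha (𝓕.mul_mem hb hc))

instance grGRing : DirectSum.GRing 𝓕.GrPiece where
  mul_zero {i j} a := (𝓕.grMul i j a).map_zero
  zero_mul {i j} b := by
    change 𝓕.grMul i j 0 b = 0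
    rw [map_zero, LinearMap.zero_apply]
  mul_add {i j} a b c := (𝓕.grMul i j a).map_add b c
  add_mul {i j} a b c := by
    change 𝓕.grMul i j (a + b) c = 𝓕.grMul i j a c + 𝓕.grMul i j b c
    rw [map_add, LinearMap.add_apply]
  natCast n := n • 𝓕.symbol 0 1 𝓕.one_mem
  natCast_zero := zero_smul _ _
  natCast_succ n := succ_nsmul _ n
  intCast n := n • 𝓕.symbol 0 1 𝓕.one_mem
  intCast_ofNat n := natCast_zsmul _ n
  intCast_negSucc_ofNat n := negSucc_zsmul _ n

instance grGAlgebra : DirectSum.GAlgebra R 𝓕.GrPiece where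
  toFun := ((LinearMap.toSpanSingleton R (𝓕.GrPiece 0) (𝓕.symbol 0 1 𝓕.one_mem)).toAddMonoidHom)
  map_one := one_smul R (𝓕.symbol 0 1 𝓕.one_mem)
  map_mul r s := by
    refine 𝓕.mk_symbol_eq (i := 0) (j := 0 + 0) (a := (r * s) • (1 : A)) (b := (r • 1) * (s • 1))
      rfl ?_ (Submodule.smul_mem _ _ 𝓕.one_mem)
      (𝓕.mul_mem (Submodule.smul_mem _ _ 𝓕.one_mem) (Submodule.smul_mem _ _ 𝓕.one_mem))
    rw [smul_mul_smul_comm, one_mul]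
  commutes := by
    rintro r ⟨i, x⟩
    obtain ⟨a, ha, rfl⟩ := 𝓕.symbol_surjective x
    refine 𝓕.mk_symbol_eq (a := (r • (1 : A)) * a) (b := a * (r • 1)) (add_comm 0 i) ?_
      (𝓕.mul_mem (Submodule.smul_mem _ _ 𝓕.one_mem) ha)
      (𝓕.mul_mem ha (Submodule.smul_mem _ _ 𝓕.one_mem))
    rw [smul_mul_assoc, mul_smul_comm, one_mul, mul_one]
  smul_def := by
    rintro r ⟨i, x⟩
    obtain ⟨a, ha, rfl⟩ := 𝓕.symbol_surjective x
    refine 𝓕.mk_symbol_eq (a := r • a) (b := (r • (1 : A)) * a) (zero_add i).symm ?_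
      (Submodule.smul_mem _ _ ha)
      (𝓕.mul_mem (Submodule.smul_mem _ _ 𝓕.one_mem) ha)
    rw [smul_mul_assoc, one_mul]

/-- The associated graded algebra `gr A = ⨁ n, F n / F (n - 1)`. -/
def Gr : Type v := ⨁ n, 𝓕.GrPiece n

instance : Ring 𝓕.Gr := inferInstanceAs (Ring (⨁ n, 𝓕.GrPiece n))

instance : Algebra R 𝓕.Gr := inferInstanceAs (Algebra R (⨁ n, 𝓕.GrPiece n))

/-- The inclusion of the degree `n` piece in `gr A`. -/
def grOf (n : ℕ) : 𝓕.GrPiece n →ₗ[R] 𝓕.Gr := DirectSum.lof R ℕ 𝓕.GrPiece n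

lemma grOf_symbol_mul {i j : ℕ} {a b : A} (ha : a ∈ 𝓕.F i) (hb : b ∈ 𝓕.F j) :
    𝓕.grOf i (𝓕.symbol i a ha) * 𝓕.grOf j (𝓕.symbol j b hb) =
      𝓕.grOf (i + j) (𝓕.symbol (i + j) (a * b) (𝓕.mul_mem ha hb)) :=
  DirectSum.of_mul_of (A := 𝓕.GrPiece) _ _

/-- A filtration is locally finite if each `F n` is a finitely generated `R`-module. -/
def LocallyFinite : Prop := ∀ n, Module.Finite R (𝓕.F n)

/-- The graded algebra `gr A` is locally finite if each graded piece is a finitely generated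
`R`-module. -/
def GrLocallyFinite : Prop := ∀ n, Module.Finite R (𝓕.GrPiece n)

end Gr

section Induced

variable {k : Type u} {A : Type v} [CommRing k] [Ring A] [Algebra k A] (𝓕 : AlgFiltration k A)
  (D : Type u) [CommRing D] [Algebra D k] [Algebra D A] [IsScalarTower D k A] (B : Subalgebra D A)

/-- The filtration `B ∩ F n` induced on a `D`-subalgebra `B` of the filtered algebra `A`. -/
def induced : AlgFiltration D B where
  F n := ((𝓕.F n).restrictScalars D).comap B.val.toLinearMap
  mono _ _ h _ hx := 𝓕.mono h hx
  one_mem := 𝓕.one_mem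
  mul_mem ha hb := 𝓕.mul_mem ha hb
  exhaustive a := 𝓕.exhaustive (a : A)

lemma induced_prev_mem {n : ℕ} {b : B} (hb : b ∈ (𝓕.induced D B).prev n) :
    (b : A) ∈ 𝓕.prev n := by
  cases n with
  | zero =>
    have h0 : b = 0 := (Submodule.mem_bot D).1 hb
    rw [h0]
    exact zero_mem _
  | succ n => exact hb

variable [Algebra D 𝓕.Gr] [IsScalarTower D k 𝓕.Gr]

/-- The natural map `(B ∩ F n) / (B ∩ F (n - 1)) → F n / F (n - 1)`, followed by the inclusion
in `gr A`. -/
def grMapPiece (n : ℕ) : (𝓕.induced D B).GrPiece n →ₗ[D] 𝓕.Gr :=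
  (𝓕.induced D B).grPieceLift n
    { toFun := fun b => 𝓕.grOf n (𝓕.symbol n ((b : B) : A) b.2)
      map_add' := fun b b' => (𝓕.grOf n).map_add (𝓕.symbol n ((b : B) : A) b.2)
        (𝓕.symbol n ((b' : B) : A) b'.2)
      map_smul' := fun r b => by
        have h1 : 𝓕.symbol n (((r • b : (𝓕.induced D B).F n) : B) : A) (r • b).2 =
            algebraMap D k r • 𝓕.symbol n ((b : B) : A) b.2 :=
          𝓕.symbol_congr (algebraMap_smul k r ((b : B) : A)).symm _
            (Submodule.smul_mem _ _ b.2)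
        rw [h1, map_smul, algebraMap_smul, RingHom.id_apply] }
    (fun b hb => by
      have h0 : 𝓕.symbol n ((b : B) : A) b.2 = 0 :=
        𝓕.symbol_eq_zero.2 (𝓕.induced_prev_mem D B hb)
      exact (congrArg (𝓕.grOf n) h0).trans (map_zero _))

lemma grMapPiece_symbol {n : ℕ} {b : B} (hb : b ∈ (𝓕.induced D B).F n) :
    𝓕.grMapPiece D B n ((𝓕.induced D B).symbol n b hb) = 𝓕.grOf n (𝓕.symbol n (b : A) hb) := rfl

/-- The natural `D`-algebra map `gr B → gr A`, for the induced filtration on `B`. -/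
def grMap : (𝓕.induced D B).Gr →ₐ[D] 𝓕.Gr :=
  DirectSum.toAlgebra D (𝓕.induced D B).GrPiece (𝓕.grMapPiece D B)
    (𝓕.grMapPiece_symbol D B (𝓕.induced D B).one_mem) (by
      intro i j x y
      obtain ⟨a, ha, rfl⟩ := (𝓕.induced D B).symbol_surjective x
      obtain ⟨b, hb, rfl⟩ := (𝓕.induced D B).symbol_surjective y
      exact (𝓕.grMapPiece_symbol D B ((𝓕.induced D B).mul_mem ha hb)).trans
        (𝓕.grOf_symbol_mul (i := i) (j := j) (a := (a : A)) (b := (b : A)) ha hb).symm)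

end Induced

end AlgFiltration

/-! ### Congenial algebras -/

/-- A ring is noetherian if it is left and right noetherian. -/
def IsTwoSidedNoetherian (S : Type v) [Ring S] : Prop :=
  IsNoetherianRing S ∧ IsNoetherianRing Sᵐᵒᵖ

/-- The `R`-algebra `S` is strongly noetherian: `S ⊗ C` is noetherian for every commutative
noetherian `R`-algebra `C` (in the universe `w`). -/
def IsStronglyNoetherian (R : Type u) (S : Type v) [CommRing R] [Ring S] [Algebra R S] : Prop :=
  ∀ (C : Type w) [CommRing C] [Algebra R C] [IsNoetherianRing C],
    IsTwoSidedNoetherian (S ⊗[R] C)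

/-- The algebra `S` over the field `K` is PI: it satisfies a nonzero polynomial identity in
noncommuting variables. -/
def IsPIAlgebra (K : Type u) (S : Type v) [Field K] [Ring S] [Algebra K S] : Prop :=
  ∃ f : FreeAlgebra K ℕ, f ≠ 0 ∧ ∀ s : ℕ → S, FreeAlgebra.lift K s f = 0

/-- For a subring `D` of the field `k`, a `k`-algebra `A` and a `D`-algebra `B` with a `D`-algebra
map `f : B → A`: the map `f` identifies `B` with an order of `A`, that is, with a `D`-subalgebra of
`A` which is free over `D` and for which `k ⊗[D] B → A` is bijective. -/
def IsOrderOf {k : Type u} [Field k] (D : Subalgebra ℤ k) {B A : Type v} [Ring B] [Ring A]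
    [Algebra D B] [Algebra k A] (f : B →ₐ[D] A) : Prop :=
  Function.Injective f ∧ Module.Free D B ∧ IsBaseChange k f.toLinearMap

/-- The `k`-algebra `A` is congenial with respect to the filtration `𝓕`. Subrings of `k` which are
affine over `ℤ` are the `D : Subalgebra ℤ k` with `D.FG`; the factor rings of `D` which are finite
fields are the finite rings `D ⧸ I` with `I` maximal. -/
def IsCongenial {k : Type u} {A : Type v} [Field k] [Ring A] [Algebra k A]
    (𝓕 : AlgFiltration k A) : Prop :=
  𝓕.LocallyFinite ∧
  ∃ (D : Subalgebra ℤ k) (B : Subalgebra D A),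
    D.FG ∧
    IsOrderOf D B.val ∧
    (𝓕.induced D B).LocallyFinite ∧
    IsOrderOf D (𝓕.grMap D B) ∧
    IsStronglyNoetherian.{u, v, w} D (𝓕.induced D B).Gr ∧
    (𝓕.induced D B).GrLocallyFinite ∧
    ∀ (I : Ideal D) [I.IsMaximal], Finite (D ⧸ I) →
      letI : Field (D ⧸ I) := Ideal.Quotient.field I
      Algebra.FiniteType (D ⧸ I) ((D ⧸ I) ⊗[D] B) ∧
      IsTwoSidedNoetherian ((D ⧸ I) ⊗[D] B) ∧
      IsPIAlgebra (D ⧸ I) ((D ⧸ I) ⊗[D] B)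

/-! ### Lie superalgebras and their enveloping algebras -/

/-- The sign `(-1) ^ (|x| |y|)` for parities `|x| = i` and `|y| = j`. -/
def superSign (i j : ZMod 2) : ℤ := (-1) ^ (i.val * j.val)

/-- A Lie superalgebra structure on a vector space `L` over the field `k` (of characteristic other
than `2` and `3`): a `ZMod 2`-grading and a bilinear bracket which respects the grading, is super
skew-symmetric and satisfies the super Jacobi identity. -/
structure LieSuperalgebra (k : Type u) (L : Type v) [Field k] [AddCommGroup L] [Module k L] where
  part : ZMod 2 → Submodule k L
  isInternal : DirectSum.IsInternal part
  bracket : L →ₗ[k] L →ₗ[k] L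
  bracket_mem : ∀ {i j : ZMod 2} {x y : L}, x ∈ part i → y ∈ part j → bracket x y ∈ part (i + j)
  skew : ∀ {i j : ZMod 2} {x y : L}, x ∈ part i → y ∈ part j →
    bracket x y = -(superSign i j • bracket y x)
  jacobi : ∀ {i j l : ZMod 2} {x y z : L}, x ∈ part i → y ∈ part j → z ∈ part l →
    superSign i l • bracket x (bracket y z) + superSign j i • bracket y (bracket z x) +
      superSign l j • bracket z (bracket x y) = 0

namespace LieSuperalgebra

variable {k : Type u} {L : Type v} [Field k] [AddCommGroup L] [Module k L]
  (S : LieSuperalgebra k L)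

/-- The relations `x ⊗ y - (-1) ^ (|x| |y|) y ⊗ x = [x, y]`, for `x` and `y` homogeneous, in the
tensor algebra of `L`. -/
inductive EnvRel : TensorAlgebra k L → TensorAlgebra k L → Prop
  | mk {i j : ZMod 2} {x y : L} (hx : x ∈ S.part i) (hy : y ∈ S.part j) :
      EnvRel
        (TensorAlgebra.ι k x * TensorAlgebra.ι k y -
          superSign i j • (TensorAlgebra.ι k y * TensorAlgebra.ι k x))
        (TensorAlgebra.ι k (S.bracket x y))

/-- The universal enveloping algebra `U(L)`: the quotient of the tensor algebra by the two-sided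
ideal generated by the relations. -/
def Env : Type (max u v) := RingQuot S.EnvRel

instance : Ring S.Env := inferInstanceAs (Ring (RingQuot S.EnvRel))

instance : Algebra k S.Env := inferInstanceAs (Algebra k (RingQuot S.EnvRel))

/-- The quotient map from the tensor algebra to `U(L)`. -/
def mkEnv : TensorAlgebra k L →ₐ[k] S.Env := RingQuot.mkAlgHom k S.EnvRel

/-- The canonical map `L → U(L)`. -/
def ι : L →ₗ[k] S.Env := S.mkEnv.toLinearMap.comp (TensorAlgebra.ι k)

lemma one_le_one_sup : (1 : Submodule k S.Env) ≤ 1 ⊔ LinearMap.range S.ι := le_sup_left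

/-- The standard PBW filtration on `U(L)`: `F n = (k + L) ^ n` is the span of all products of at
most `n` elements of `L`. -/
def pbwFiltration : AlgFiltration k S.Env where
  F n := (1 ⊔ LinearMap.range S.ι) ^ n
  mono _ _ h := pow_le_pow_right₀ S.one_le_one_sup h
  one_mem := by
    rw [pow_zero]
    exact Submodule.one_le.1 le_rfl
  mul_mem {i j a b} ha hb := by
    rw [pow_add]
    exact Submodule.mul_mem_mul ha hb
  exhaustive a := by
    obtain ⟨t, rfl⟩ : ∃ t, S.mkEnv t = a := RingQuot.mkAlgHom_surjective k S.EnvRel a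
    induction t using TensorAlgebra.induction with
    | algebraMap r =>
      refine ⟨0, ?_⟩
      rw [AlgHom.commutes, pow_zero]
      exact Submodule.algebraMap_mem r
    | ι x =>
      refine ⟨1, ?_⟩
      rw [pow_one]
      exact Submodule.mem_sup_right ⟨x, rfl⟩
    | mul s t hs ht =>
      obtain ⟨m, hm⟩ := hs
      obtain ⟨n, hn⟩ := ht
      refine ⟨m + n, ?_⟩
      rw [map_mul, pow_add]
      exact Submodule.mul_mem_mul hm hn
    | add s t hs ht =>
      obtain ⟨m, hm⟩ := hs
      obtain ⟨n, hn⟩ := ht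
      refine ⟨max m n, ?_⟩
      rw [map_add]
      exact add_mem (pow_le_pow_right₀ S.one_le_one_sup (le_max_left m n) hm)
        (pow_le_pow_right₀ S.one_le_one_sup (le_max_right m n) hn)

end LieSuperalgebra

end

/-! Let `x` be the images in U(L) of a homogeneous basis of L. Two of them commute up to sign modulo
the span V of all the `x i`, so ordered monomials span U(L), compatibly with degree. The PBW theorem
is not needed. Call an exponent normal if its monomial is not a combination of monomials smaller in
the degree lexicographic order. Normal monomials form a basis of U(L) adapted to the filtration
(`linearIndependent_normal`, `wordSpan_eq_span_normal`).

Monomials multiply like exponents, up to sign and smaller terms, so the exponents that are not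
normal form an up-set. By Dickson's lemma it has finitely many minimal elements. The scalars in the
corresponding finitely many reductions, together with those in the commutation relations, generate
the ring D (`exists_fg_coefficients`). The same normal exponents then index a D-basis of A_D, the
D-subalgebra generated by the `x i`, and bases of gr A_D over D and of gr U(L) over k. Freeness,
base change and local finiteness are read off from these bases.

Both noetherian claims, and the polynomial identity, come from finiteness over a polynomial ring
acting centrally (`exists_finite_mvPolynomial`). In gr A_D the generators commute up to sign, so
their squares are central, and this survives any base change. Over a finite field of characteristic
p, put u = x_i for x_i even and u = x_i² for x_i odd; then ad u preserves the finite set V. Since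
(ad u)^(p^m) = ad(u^(p^m)), two such powers agree on V, and a difference u^(p^b) - u^(p^a) is
central. A ring generated by d elements as a module over a central subring satisfies the standard
identity of degree d + 1. -/

/-! ### Words and ordered monomials in generators that commute up to sign -/

section Words

variable {R A : Type*} [CommRing R] [Ring A] [Algebra R A] {n : ℕ}

/-- The product of the generators `x i` along a word `l`. -/
def wordProd (x : Fin n → A) (l : List (Fin n)) : A := (l.map x).prod

lemma wordProd_cons (x : Fin n → A) (i : Fin n) (l : List (Fin n)) :
    wordProd x (i :: l) = x i * wordProd x l := by
  simp [wordProd]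

lemma wordProd_append (x : Fin n → A) (l l' : List (Fin n)) :
    wordProd x (l ++ l') = wordProd x l * wordProd x l' := by
  simp [wordProd]

lemma map_wordProd {B : Type*} [Ring B] (f : A →+* B) (x : Fin n → A) (l : List (Fin n)) :
    f (wordProd x l) = wordProd (fun i => f (x i)) l := by
  rw [wordProd, map_list_prod, List.map_map]
  rfl

variable (R) in
/-- The span of the products of fewer than `d` generators. -/
def wordSpan (x : Fin n → A) (d : ℕ) : Submodule R A :=
  Submodule.span R (wordProd x '' {l | l.length < d})

lemma wordProd_mem_wordSpan (x : Fin n → A) {l : List (Fin n)} {d : ℕ} (h : l.length < d) :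
    wordProd x l ∈ wordSpan R x d :=
  Submodule.subset_span ⟨l, h, rfl⟩

lemma wordSpan_mono (x : Fin n → A) : Monotone (wordSpan R x) := fun _ _ h =>
  Submodule.span_mono (Set.image_mono fun _ hl => lt_of_lt_of_le hl h)

lemma span_range_le_wordSpan (x : Fin n → A) :
    Submodule.span R (Set.range x) ≤ wordSpan R x 2 := by
  rw [Submodule.span_le]
  rintro _ ⟨i, rfl⟩
  have h : wordProd x [i] ∈ wordSpan R x 2 := wordProd_mem_wordSpan x (by simp)
  simpa [wordProd] using h

lemma wordProd_mul_mem (x : Fin n → A) (l : List (Fin n)) {d : ℕ} {a : A}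
    (ha : a ∈ wordSpan R x d) : wordProd x l * a ∈ wordSpan R x (l.length + d) := by
  have h : wordSpan R x d ≤ (wordSpan R x (l.length + d)).comap (LinearMap.mulLeft R (wordProd x l)) := by
    refine Submodule.span_le.2 ?_
    rintro _ ⟨l', hl', rfl⟩
    change wordProd x l * wordProd x l' ∈ wordSpan R x _
    rw [← wordProd_append]
    exact wordProd_mem_wordSpan x (by simpa using hl')
  exact h ha

lemma mul_wordProd_mem (x : Fin n → A) (l : List (Fin n)) {d : ℕ} {a : A}
    (ha : a ∈ wordSpan R x d) : a * wordProd x l ∈ wordSpan R x (d + l.length) := by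
  have h : wordSpan R x d ≤ (wordSpan R x (d + l.length)).comap (LinearMap.mulRight R (wordProd x l)) := by
    refine Submodule.span_le.2 ?_
    rintro _ ⟨l', hl', rfl⟩
    change wordProd x l' * wordProd x l ∈ wordSpan R x _
    rw [← wordProd_append]
    exact wordProd_mem_wordSpan x (by simpa using hl')
  exact h ha

lemma units_smul_mem {M : Type*} [AddCommGroup M] [Module R M] (p : Submodule R M) (s : ℤˣ) {a : M}
    (ha : a ∈ p) : s • a ∈ p := by
  rw [Units.smul_def]
  exact p.smul_of_tower_mem (s : ℤ) ha

variable (R) in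
/-- The elements `x i` commute up to signs, modulo the `R`-span of all `x l`. -/
def SignCommuting (x : Fin n → A) : Prop :=
  ∀ i j, ∃ s : ℤˣ, x i * x j - s • (x j * x i) ∈ Submodule.span R (Set.range x)

/-- Induction on the permutation: an adjacent swap costs a sign and an error in which two letters
are replaced by one, hence a combination of strictly shorter words. -/
lemma wordProd_perm {x : Fin n → A} (H : SignCommuting R x) {l l' : List (Fin n)}
    (h : l.Perm l') : ∃ s : ℤˣ, wordProd x l - s • wordProd x l' ∈ wordSpan R x l.length := by
  induction h with
  | nil => exact ⟨1, by simp⟩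
  | cons i h ih =>
    obtain ⟨s, hs⟩ := ih
    refine ⟨s, ?_⟩
    have := wordProd_mul_mem x [i] hs
    rw [wordProd_cons, wordProd_cons, ← mul_smul_comm, ← mul_sub]
    simpa [wordProd, add_comm] using this
  | swap i j l =>
    obtain ⟨s, hs⟩ := H j i
    refine ⟨s, ?_⟩
    have := mul_wordProd_mem x l (span_range_le_wordSpan x hs)
    simp only [wordProd_cons, ← mul_assoc]
    rw [← smul_mul_assoc, ← sub_mul]
    simpa [add_comm, add_left_comm] using this
  | trans h₁ h₂ ih₁ ih₂ =>
    obtain ⟨s, hs⟩ := ih₁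
    obtain ⟨t, ht⟩ := ih₂
    refine ⟨s * t, ?_⟩
    rw [← h₁.length_eq] at ht
    have := add_mem hs (units_smul_mem _ s ht)
    rwa [smul_sub, smul_smul, sub_add_sub_cancel] at this

/-- The nondecreasing word with exponents `e`. -/
def expList (e : Fin n →₀ ℕ) : List (Fin n) :=
  (List.finRange n).flatMap fun i => List.replicate (e i) i

lemma count_expList (e : Fin n →₀ ℕ) (i : Fin n) : (expList e).count i = e i := by
  rw [expList, List.count_flatMap, ← Fin.sum_univ_def]
  simp [List.count_replicate]

lemma length_expList (e : Fin n →₀ ℕ) : (expList e).length = e.degree := by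
  rw [expList, List.length_flatMap, ← Fin.sum_univ_def, Finsupp.degree_eq_sum]
  simp

lemma expList_add_perm (e f : Fin n →₀ ℕ) : (expList e ++ expList f).Perm (expList (e + f)) := by
  simp [List.perm_iff_count, count_expList]

lemma exists_perm_expList (l : List (Fin n)) : ∃ e, l.Perm (expList e) :=
  ⟨Finsupp.equivFunOnFinite.symm fun i => l.count i, by simp [List.perm_iff_count, count_expList]⟩

/-- The ordered monomial with exponents `e`. -/
def monoProd (x : Fin n → A) (e : Fin n →₀ ℕ) : A := wordProd x (expList e)

lemma monoProd_mem_wordSpan (x : Fin n → A) {e : Fin n →₀ ℕ} {d : ℕ} (h : e.degree < d) :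
    monoProd x e ∈ wordSpan R x d :=
  wordProd_mem_wordSpan x (by rwa [length_expList])

lemma span_monoProd_mono (x : Fin n → A) {p q : (Fin n →₀ ℕ) → Prop} (h : ∀ e, p e → q e) :
    Submodule.span R (monoProd x '' {e | p e}) ≤ Submodule.span R (monoProd x '' {e | q e}) :=
  Submodule.span_mono (Set.image_mono h)

lemma wordSpan_eq_span_monoProd {x : Fin n → A} (H : SignCommuting R x) (d : ℕ) :
    wordSpan R x d = Submodule.span R (monoProd x '' {e | e.degree < d}) := by
  refine le_antisymm ?_ (Submodule.span_le.2 ?_)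
  -- Sorting a word of length below `d` leaves an error in shorter words, to which the induction
  -- hypothesis applies at the length of that word.
  · induction d using Nat.strong_induction_on with
    | _ d ih =>
      refine Submodule.span_le.2 ?_
      rintro _ ⟨l, hl, rfl⟩
      obtain ⟨e, he⟩ := exists_perm_expList l
      obtain ⟨s, hs⟩ := wordProd_perm H he
      have hd : e.degree < d := by rwa [← length_expList, ← he.length_eq]
      have h1 := span_monoProd_mono x (fun f (hf : f.degree < l.length) => hf.trans hl) (ih _ hl hs)
      have h2 : monoProd x e ∈ Submodule.span R (monoProd x '' {e | e.degree < d}) :=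
        Submodule.subset_span ⟨e, hd, rfl⟩
      have := add_mem h1 (units_smul_mem _ s h2)
      rwa [monoProd, sub_add_cancel] at this
  · rintro _ ⟨e, he, rfl⟩
    exact monoProd_mem_wordSpan x he

/-! ### Leading monomials -/

variable (R) in
/-- The span of the ordered monomials smaller than `e` in the degree lexicographic order. -/
def lowerSpan (x : Fin n → A) (e : Fin n →₀ ℕ) : Submodule R A :=
  Submodule.span R (monoProd x '' {f | toDegLex f < toDegLex e})

lemma toDegLex_lt_of_degree_lt {e f : Fin n →₀ ℕ} (h : e.degree < f.degree) :
    toDegLex e < toDegLex f :=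
  Finsupp.DegLex.lt_iff.2 (Or.inl h)

lemma degree_le_of_toDegLex_le {e f : Fin n →₀ ℕ} (h : toDegLex e ≤ toDegLex f) :
    e.degree ≤ f.degree :=
  Finsupp.DegLex.monotone_degree h

lemma lowerSpan_mono (x : Fin n → A) {e f : Fin n →₀ ℕ} (h : toDegLex e ≤ toDegLex f) :
    lowerSpan R x e ≤ lowerSpan R x f :=
  Submodule.span_mono (Set.image_mono fun _ hg => lt_of_lt_of_le hg h)

lemma wordSpan_le_lowerSpan {x : Fin n → A} (H : SignCommuting R x) (e : Fin n →₀ ℕ) :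
    wordSpan R x e.degree ≤ lowerSpan R x e := by
  rw [wordSpan_eq_span_monoProd H]
  exact Submodule.span_mono (Set.image_mono fun _ hf => toDegLex_lt_of_degree_lt hf)

lemma exists_monoProd_mul {x : Fin n → A} (H : SignCommuting R x) (e f : Fin n →₀ ℕ) :
    ∃ s : ℤˣ, monoProd x e * monoProd x f - s • monoProd x (e + f) ∈ lowerSpan R x (e + f) := by
  obtain ⟨s, hs⟩ := wordProd_perm H (expList_add_perm e f)
  refine ⟨s, wordSpan_le_lowerSpan H _ ?_⟩
  rwa [wordProd_append, List.length_append, length_expList, length_expList, ← map_add] at hs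

lemma monoProd_mul_mem_lowerSpan {x : Fin n → A} (H : SignCommuting R x) (e f : Fin n →₀ ℕ) {a : A}
    (ha : a ∈ lowerSpan R x f) : monoProd x e * a ∈ lowerSpan R x (e + f) := by
  have h : lowerSpan R x f ≤ (lowerSpan R x (e + f)).comap (LinearMap.mulLeft R (monoProd x e)) := by
    refine Submodule.span_le.2 ?_
    rintro _ ⟨g, hg, rfl⟩
    change monoProd x e * monoProd x g ∈ lowerSpan R x _
    have hlt : toDegLex (e + g) < toDegLex (e + f) := by
      rw [toDegLex_add, toDegLex_add]
      exact add_lt_add_right (show toDegLex g < toDegLex f from hg) _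
    obtain ⟨s, hs⟩ := exists_monoProd_mul H e g
    have h2 : monoProd x (e + g) ∈ lowerSpan R x (e + f) := Submodule.subset_span ⟨_, hlt, rfl⟩
    have := add_mem (lowerSpan_mono x hlt.le hs) (units_smul_mem _ s h2)
    rwa [sub_add_cancel] at this
  exact h ha

/-- Multiplying a reduction of `e` by the monomial of `f - e` gives a reduction of `f`. The leading
coefficient that appears is a sign, so it can be inverted over any ring of coefficients. -/
lemma monoProd_mem_lowerSpan_of_le {x : Fin n → A} (H : SignCommuting R x) {e f : Fin n →₀ ℕ}
    (hef : e ≤ f) (he : monoProd x e ∈ lowerSpan R x e) : monoProd x f ∈ lowerSpan R x f := by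
  obtain ⟨g, rfl⟩ := exists_add_of_le hef
  rw [add_comm e g]
  obtain ⟨s, hs⟩ := exists_monoProd_mul H g e
  have := units_smul_mem _ s⁻¹ (sub_mem (monoProd_mul_mem_lowerSpan H g e he) hs)
  rwa [sub_sub_cancel, smul_smul, inv_mul_cancel, one_smul] at this

/-- The degree lexicographic order is a well-order, so replacing monomials outside `N` by smaller
ones terminates. -/
lemma monoProd_mem_span_of_reduction {x : Fin n → A} {N : Set (Fin n →₀ ℕ)}
    (hN : ∀ e ∉ N, monoProd x e ∈ lowerSpan R x e) (e : Fin n →₀ ℕ) :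
    monoProd x e ∈ Submodule.span R (monoProd x '' {f | f ∈ N ∧ toDegLex f ≤ toDegLex e}) := by
  suffices ∀ e : DegLex (Fin n →₀ ℕ), monoProd x (ofDegLex e) ∈
      Submodule.span R (monoProd x '' {f | f ∈ N ∧ toDegLex f ≤ e}) from this (toDegLex e)
  intro e
  induction e using WellFoundedLT.induction with
  | _ e ih =>
    by_cases he : ofDegLex e ∈ N
    · exact Submodule.subset_span ⟨_, ⟨he, le_rfl⟩, rfl⟩
    · refine (Submodule.span_le.2 ?_ : lowerSpan R x (ofDegLex e) ≤ _) (hN _ he)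
      rintro _ ⟨f, hf, rfl⟩
      exact span_monoProd_mono x (fun g hg => ⟨hg.1, hg.2.trans (le_of_lt hf)⟩)
        (ih (toDegLex f) hf)

lemma wordSpan_eq_span_normal {x : Fin n → A} (H : SignCommuting R x) {N : Set (Fin n →₀ ℕ)}
    (hN : ∀ e ∉ N, monoProd x e ∈ lowerSpan R x e) (d : ℕ) :
    wordSpan R x d = Submodule.span R (monoProd x '' {e | e ∈ N ∧ e.degree < d}) := by
  rw [wordSpan_eq_span_monoProd H]
  refine le_antisymm (Submodule.span_le.2 ?_)
    (Submodule.span_mono (Set.image_mono fun _ he => he.2))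
  rintro _ ⟨e, he, rfl⟩
  exact span_monoProd_mono x (fun g hg =>
    ⟨hg.1, lt_of_le_of_lt (degree_le_of_toDegLex_le hg.2) he⟩) (monoProd_mem_span_of_reduction hN e)

/-- A family in which no vector lies in the span of the preceding ones is linearly independent. -/
lemma linearIndependent_of_notMem_span_lt {K M ι : Type*} [Field K] [AddCommGroup M] [Module K M]
    [LinearOrder ι] (b : ι → M) (hb : ∀ i, b i ∉ Submodule.span K (b '' {j | j < i})) :
    LinearIndependent K b := by
  classical
  rw [linearIndependent_iff']
  intro s g hg
  by_contra! hne
  obtain ⟨i₀, hi₀, hgi₀⟩ := hne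
  let t := s.filter fun i => g i ≠ 0
  have ht : t.Nonempty := ⟨i₀, by simp [t, hi₀, hgi₀]⟩
  -- The largest index with nonzero coefficient: solving the relation for its vector puts it in the
  -- span of the preceding ones.
  set m := t.max' ht
  have hm : m ∈ t := t.max'_mem ht
  have hm2 : g m ≠ 0 := (Finset.mem_filter.1 hm).2
  have hsum : ∑ i ∈ t, g i • b i = 0 := by
    rw [← hg]
    refine Finset.sum_subset (Finset.filter_subset _ _) fun i hi hit => ?_
    have : g i = 0 := by simpa [t, hi] using hit
    rw [this, zero_smul]
  rw [← Finset.add_sum_erase _ _ hm] at hsum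
  refine hb m ((Submodule.smul_mem_iff _ hm2).1 ?_)
  rw [eq_neg_of_add_eq_zero_left hsum]
  refine neg_mem (sum_mem fun i hi => Submodule.smul_mem _ _ (Submodule.subset_span ⟨i, ?_, rfl⟩))
  exact lt_of_le_of_ne (t.le_max' _ (Finset.mem_of_mem_erase hi)) (Finset.ne_of_mem_erase hi)

/-- The exponents whose monomial is not a combination of smaller monomials. -/
def normalExp (K : Type*) [Field K] [Algebra K A] (x : Fin n → A) : Set (Fin n →₀ ℕ) :=
  {e | monoProd x e ∉ lowerSpan K x e}

lemma linearIndependent_normal {K : Type*} [Field K] [Algebra K A] (x : Fin n → A) :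
    LinearIndependent K fun e : normalExp K x => monoProd x (e : Fin n →₀ ℕ) := by
  let _ : LinearOrder (normalExp K x) :=
    LinearOrder.lift' (fun e : normalExp K x => toDegLex (e : Fin n →₀ ℕ))
      (fun e f h => Subtype.ext (toDegLex_injective h))
  refine linearIndependent_of_notMem_span_lt _ fun e he => e.2 ?_
  refine Submodule.span_mono ?_ he
  rintro _ ⟨f, hf, rfl⟩
  exact ⟨f, hf, rfl⟩

end Words

/-! ### Generation and homomorphisms -/

section Generation

variable {R A B : Type*} [CommRing R] [Ring A] [Algebra R A] [Ring B] [Algebra R B] {n : ℕ}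

/-- Word spans use strict length bounds, so lengths at most `c` and below `d` add up to a length
below `c + d`. -/
lemma mul_mem_wordSpan (x : Fin n → A) {c d : ℕ} {a b : A} (ha : a ∈ wordSpan R x (c + 1))
    (hb : b ∈ wordSpan R x d) : a * b ∈ wordSpan R x (c + d) := by
  have h : wordSpan R x d ≤ (wordSpan R x (c + d)).comap (LinearMap.mulLeft R a) := by
    refine Submodule.span_le.2 ?_
    rintro _ ⟨l, hl, rfl⟩
    have hl' : l.length < d := hl
    exact wordSpan_mono x (by omega) (mul_wordProd_mem x l ha)
  exact h hb

lemma exists_mem_wordSpan {x : Fin n → A} (hx : Algebra.adjoin R (Set.range x) = ⊤) (a : A) :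
    ∃ d, a ∈ wordSpan R x d := by
  have ha : a ∈ Algebra.adjoin R (Set.range x) := hx ▸ Algebra.mem_top
  induction ha using Algebra.adjoin_induction with
  | mem y hy =>
    exact ⟨2, span_range_le_wordSpan x (Submodule.subset_span hy)⟩
  | algebraMap r =>
    refine ⟨1, ?_⟩
    rw [Algebra.algebraMap_eq_smul_one]
    exact Submodule.smul_mem _ _ (wordProd_mem_wordSpan x (l := []) Nat.zero_lt_one)
  | add a b _ _ ha hb =>
    obtain ⟨c, hc⟩ := ha
    obtain ⟨d, hd⟩ := hb
    exact ⟨max c d, add_mem (wordSpan_mono x (le_max_left c d) hc)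
      (wordSpan_mono x (le_max_right c d) hd)⟩
  | mul a b _ _ ha hb =>
    obtain ⟨c, hc⟩ := ha
    obtain ⟨d, hd⟩ := hb
    exact ⟨c + d, mul_mem_wordSpan x (wordSpan_mono x (Nat.le_succ c) hc) hd⟩

lemma map_monoProd (f : A →+* B) (x : Fin n → A) (e : Fin n →₀ ℕ) :
    f (monoProd x e) = monoProd (fun i => f (x i)) e :=
  map_wordProd f x _

lemma map_lowerSpan (f : A →ₐ[R] B) (x : Fin n → A) (e : Fin n →₀ ℕ) :
    (lowerSpan R x e).map f.toLinearMap = lowerSpan R (fun i => f (x i)) e := by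
  rw [lowerSpan, lowerSpan, Submodule.map_span, ← Set.image_comp]
  congr 2
  exact funext fun g => map_monoProd (f : A →+* B) x g

lemma map_span_range (f : A →ₐ[R] B) (x : Fin n → A) :
    (Submodule.span R (Set.range x)).map f.toLinearMap =
      Submodule.span R (Set.range fun i => f (x i)) := by
  rw [Submodule.map_span, ← Set.range_comp]
  rfl

/-- This lets the relations be checked in the ambient algebra and then used in the order inside it.
-/
lemma SignCommuting.of_injective {f : A →ₐ[R] B} (hf : Function.Injective f) {x : Fin n → A}
    (H : SignCommuting R fun i => f (x i)) : SignCommuting R x := by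
  intro i j
  obtain ⟨s, hs⟩ := H i j
  refine ⟨s, (Function.Injective.mem_set_image (f := f.toLinearMap) hf |>.1 ?_)⟩
  rw [← Submodule.map_coe, SetLike.mem_coe, map_span_range]
  simpa [Units.smul_def] using hs

variable (R) in
/-- Each `x i` has a positive power with which all commutators of the `x j` lie in the `R`-span of
the `x l`. -/
def PowerNormalizing (x : Fin n → A) : Prop :=
  ∀ i, ∃ r : ℕ, 0 < r ∧ ∀ j, x i ^ r * x j - x j * x i ^ r ∈ Submodule.span R (Set.range x)

lemma PowerNormalizing.of_injective {f : A →ₐ[R] B} (hf : Function.Injective f) {x : Fin n → A}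
    (H : PowerNormalizing R fun i => f (x i)) : PowerNormalizing R x := by
  intro i
  obtain ⟨r, hr, h⟩ := H i
  refine ⟨r, hr, fun j => (Function.Injective.mem_set_image (f := f.toLinearMap) hf |>.1 ?_)⟩
  rw [← Submodule.map_coe, SetLike.mem_coe, map_span_range]
  simpa using h j

lemma span_monoProd_eq_top {x : Fin n → A} (hx : ∀ a, ∃ d, a ∈ wordSpan R x d)
    (H : SignCommuting R x) {N : Set (Fin n →₀ ℕ)}
    (hN : ∀ e ∉ N, monoProd x e ∈ lowerSpan R x e) :
    Submodule.span R (Set.range fun e : N => monoProd x (e : Fin n →₀ ℕ)) = ⊤ := by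
  refine eq_top_iff.2 fun a _ => ?_
  obtain ⟨d, hd⟩ := hx a
  rw [wordSpan_eq_span_normal H hN] at hd
  refine Submodule.span_mono ?_ hd
  rintro _ ⟨e, he, rfl⟩
  exact ⟨⟨e, he.1⟩, rfl⟩

lemma span_image_eq_wordSpan {x : Fin n → A} (H : SignCommuting R x) {N : Set (Fin n →₀ ℕ)}
    (hN : ∀ e ∉ N, monoProd x e ∈ lowerSpan R x e) (d : ℕ) :
    wordSpan R x (d + 1) = Submodule.span R ((fun e : N => monoProd x (e : Fin n →₀ ℕ)) ''
      {e | (e : Fin n →₀ ℕ).degree ≤ d}) := by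
  rw [wordSpan_eq_span_normal H hN]
  congr 1
  ext a
  constructor
  · rintro ⟨e, he, rfl⟩
    exact ⟨⟨e, he.1⟩, Nat.lt_succ_iff.1 he.2, rfl⟩
  · rintro ⟨e, he, rfl⟩
    exact ⟨e, ⟨e.2, Nat.lt_succ_iff.2 he⟩, rfl⟩

end Generation

/-! ### A finitely generated ring of coefficients -/

section Coefficients

variable {k A : Type*} [Field k] [Ring A] [Algebra k A] {n : ℕ}

/-- The conclusion covers every `D` containing `T`, so finitely many such conditions can be met by
one `D`. -/
lemma exists_finset_mem_span {s : Set A} {a : A} (ha : a ∈ Submodule.span k s) :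
    ∃ T : Finset k, ∀ D : Subalgebra ℤ k, (T : Set k) ⊆ D → a ∈ Submodule.span D s := by
  classical
  induction ha using Submodule.span_induction with
  | mem a ha => exact ⟨∅, fun D _ => Submodule.subset_span ha⟩
  | zero => exact ⟨∅, fun D _ => zero_mem _⟩
  | add a b _ _ ha hb =>
    obtain ⟨T, hT⟩ := ha
    obtain ⟨T', hT'⟩ := hb
    refine ⟨T ∪ T', fun D hD => ?_⟩
    rw [Finset.coe_union, Set.union_subset_iff] at hD
    exact add_mem (hT D hD.1) (hT' D hD.2)
  | smul c a _ ha =>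
    obtain ⟨T, hT⟩ := ha
    refine ⟨insert c T, fun D hD => ?_⟩
    rw [Finset.coe_insert, Set.insert_subset_iff] at hD
    exact Submodule.smul_mem _ (⟨c, hD.1⟩ : D) (hT D hD.2)

lemma exists_finset_mem_span_family {ι : Type*} [Finite ι] {s : ι → Set A} {a : ι → A}
    (ha : ∀ i, a i ∈ Submodule.span k (s i)) :
    ∃ T : Finset k, ∀ D : Subalgebra ℤ k, (T : Set k) ⊆ D →
      ∀ i, a i ∈ Submodule.span D (s i) := by
  classical
  have := Fintype.ofFinite ι
  choose T hT using fun i => exists_finset_mem_span (ha i)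
  refine ⟨Finset.univ.biUnion T, fun D hD i => hT i D (subset_trans ?_ hD)⟩
  exact_mod_cast Finset.subset_biUnion_of_mem T (Finset.mem_univ i)

lemma exists_fg_coefficients {x : Fin n → A} (H : SignCommuting k x) (H' : PowerNormalizing k x) :
    ∃ D : Subalgebra ℤ k, D.FG ∧ SignCommuting D x ∧ PowerNormalizing D x ∧
      ∀ e ∉ normalExp k x, monoProd x e ∈ lowerSpan D x e := by
  classical
  let G : Set (Fin n →₀ ℕ) := {e | Minimal (· ∈ (normalExp k x)ᶜ) e}
  -- Dickson's lemma: exponents are well-quasi-ordered, so the antichain of minimal exponents that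
  -- are not normal is finite.
  have hG : G.Finite := WellQuasiOrderedLE.finite_of_isAntichain (setOfPred_minimal_antichain _)
  have := hG.to_subtype
  choose s hs using H
  choose r hr hrs using H'
  obtain ⟨T₁, h₁⟩ := exists_finset_mem_span_family fun p : Fin n × Fin n => hs p.1 p.2
  obtain ⟨T₂, h₂⟩ := exists_finset_mem_span_family fun p : Fin n × Fin n => hrs p.1 p.2
  obtain ⟨T₃, h₃⟩ := exists_finset_mem_span_family (k := k)
    (s := fun g : G => monoProd x '' {f | toDegLex f < toDegLex (g : Fin n →₀ ℕ)})
    (a := fun g : G => monoProd x (g : Fin n →₀ ℕ)) (fun g => not_not.1 g.2.1)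
  let D : Subalgebra ℤ k := Algebra.adjoin ℤ (T₁ ∪ T₂ ∪ T₃ : Finset k)
  have hD : ((T₁ ∪ T₂ ∪ T₃ : Finset k) : Set k) ⊆ D := Algebra.subset_adjoin
  rw [Finset.coe_union, Finset.coe_union, Set.union_subset_iff, Set.union_subset_iff] at hD
  have hsign : SignCommuting D x := fun i j => ⟨s i j, h₁ D hD.1.1 (i, j)⟩
  refine ⟨D, Subalgebra.fg_adjoin_finset _, hsign,
    fun i => ⟨r i, hr i, fun j => h₂ D hD.1.2 (i, j)⟩, fun e he => ?_⟩
  -- Reductions at minimal exponents propagate upwards without new scalars, because only signs are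
  -- inverted.
  obtain ⟨g, hge, hg⟩ := exists_minimal_le_of_wellFoundedLT (· ∈ (normalExp k x)ᶜ) e he
  exact monoProd_mem_lowerSpan_of_le hsign hge (h₃ D hD.2 ⟨g, hg⟩)

end Coefficients

/-! ### Bases adapted to a filtration -/

lemma dfinsuppBasis_apply {R ι : Type*} [DecidableEq ι] [Semiring R] {M : ι → Type*}
    [∀ i, AddCommMonoid (M i)] [∀ i, Module R (M i)] {η : ι → Type*}
    (b : ∀ i, Module.Basis (η i) R (M i)) (i : ι) (j : η i) :
    DFinsupp.basis b ⟨i, j⟩ = DFinsupp.single i (b i j) := by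
  classical
  refine (DFinsupp.basis b).repr.injective ?_
  rw [Module.Basis.repr_self]
  change _ = (sigmaFinsuppLequivDFinsupp R).symm
    (DFinsupp.mapRange.linearEquiv (fun i => (b i).repr) (DFinsupp.single i (b i j)))
  rw [LinearEquiv.eq_symm_apply]
  simp

namespace AlgFiltration

variable {R A : Type*} [CommRing R] [Ring A] [Algebra R A] (𝓕 : AlgFiltration R A) {ι : Type*}
  (b : Module.Basis ι R A) (d : ι → ℕ)

/-- Each `F n` is spanned by the basis vectors of degree at most `n`. -/
def Adapted : Prop := ∀ n, 𝓕.F n = Submodule.span R (b '' {i | d i ≤ n})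

variable {𝓕 b d}

lemma Adapted.basis_mem (h : 𝓕.Adapted b d) {i : ι} {n : ℕ} (hi : d i ≤ n) : b i ∈ 𝓕.F n := by
  rw [h]
  exact Submodule.subset_span ⟨i, hi, rfl⟩

lemma Adapted.prev_eq (h : 𝓕.Adapted b d) (n : ℕ) :
    𝓕.prev n = Submodule.span R (b '' {i | d i < n}) := by
  cases n with
  | zero => simp [prev]
  | succ n => simpa [prev, Nat.lt_succ_iff] using h n

lemma Adapted.locallyFinite (h : 𝓕.Adapted b d) (hd : ∀ n, {i | d i ≤ n}.Finite) :
    𝓕.LocallyFinite := fun n => by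
  rw [h]
  exact Module.Finite.span_of_finite R ((hd n).image b)

lemma LocallyFinite.grLocallyFinite (h : 𝓕.LocallyFinite) : 𝓕.GrLocallyFinite := fun n => by
  have := h n
  exact inferInstanceAs (Module.Finite R (𝓕.F n ⧸ (𝓕.prev n).submoduleOf (𝓕.F n)))

/-- The coordinates of degree `n`, on `F n / F (n - 1)`. -/
noncomputable def Adapted.coord (h : 𝓕.Adapted b d) (n : ℕ) : 𝓕.GrPiece n →ₗ[R] {i // d i = n} →₀ R :=
  𝓕.grPieceLift n ((Finsupp.lsubtypeDomain {i | d i = n}).comp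
    (b.repr.toLinearMap.comp (𝓕.F n).subtype)) (fun a ha => by
      rw [h.prev_eq, Module.Basis.mem_span_image] at ha
      ext ⟨i, hi⟩
      change b.repr a i = 0
      by_contra hne
      have hlt : d i < n := ha (Finsupp.mem_support_iff.2 hne)
      exact hlt.ne hi)

/-- The basis of `F n / F (n - 1)` given by the basis vectors of degree `n`. -/
noncomputable def Adapted.pieceBasis (h : 𝓕.Adapted b d) (n : ℕ) :
    Module.Basis {i // d i = n} R (𝓕.GrPiece n) :=
  Module.Basis.mk (v := fun i => 𝓕.symbol n (b i) (h.basis_mem i.2.le))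
    (by
      -- The degree `n` coordinates send these symbols to the standard basis.
      refine LinearIndependent.of_comp (h.coord n) ?_
      convert (Finsupp.basisSingleOne (R := R) (ι := {i // d i = n})).linearIndependent using 1
      funext i
      rw [Finsupp.coe_basisSingleOne]
      ext j
      change b.repr (b i) j = _
      classical
      rw [b.repr_self, Finsupp.single_apply, Finsupp.single_apply]
      exact if_congr Subtype.ext_iff.symm rfl rfl)
    (by
      intro y _
      obtain ⟨a, ha, rfl⟩ := 𝓕.symbol_surjective y
      have ha' := ha
      rw [h] at ha'
      have key : ∀ a (_ : a ∈ Submodule.span R (b '' {i | d i ≤ n})) (ha : a ∈ 𝓕.F n),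
          𝓕.symbol n a ha ∈ Submodule.span R
            (Set.range fun i : {i // d i = n} => 𝓕.symbol n (b i) (h.basis_mem i.2.le)) := by
        intro a ha'
        induction ha' using Submodule.span_induction with
        | mem a ha =>
          obtain ⟨i, hi, rfl⟩ := ha
          intro hF
          rcases (show d i ≤ n from hi).lt_or_eq with hlt | heq
          -- A basis vector of degree below `n` already lies in the previous step, so its symbol
          -- vanishes.
          · have h0 : 𝓕.symbol n (b i) hF = 0 := by
              rw [symbol_eq_zero, h.prev_eq]
              exact Submodule.subset_span ⟨i, hlt, rfl⟩
            rw [h0]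
            exact zero_mem _
          · exact Submodule.subset_span ⟨⟨i, heq⟩, rfl⟩
        | zero =>
          intro hF
          rw [𝓕.symbol_eq_zero.2 (zero_mem _)]
          exact zero_mem _
        | add a c ha hc iha ihc =>
          intro _
          rw [← h] at ha hc
          exact add_mem (iha ha) (ihc hc)
        | smul r a ha iha =>
          intro _
          rw [← h] at ha
          exact Submodule.smul_mem _ r (iha ha)
      exact key a ha' ha)

lemma Adapted.pieceBasis_apply (h : 𝓕.Adapted b d) (n : ℕ) (i : {i // d i = n}) :
    h.pieceBasis n i = 𝓕.symbol n (b i) (h.basis_mem i.2.le) :=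
  Module.Basis.mk_apply _ _ _

/-- The basis of `gr A` given by the symbols of an adapted basis. -/
noncomputable def Adapted.grBasis (h : 𝓕.Adapted b d) : Module.Basis ι R 𝓕.Gr :=
  (DFinsupp.basis h.pieceBasis : Module.Basis (Σ n, {i // d i = n}) R (⨁ n, 𝓕.GrPiece n)).reindex
    (Equiv.sigmaFiberEquiv d)

lemma Adapted.grBasis_apply (h : 𝓕.Adapted b d) (i : ι) :
    h.grBasis i = 𝓕.grOf (d i) (𝓕.symbol (d i) (b i) (h.basis_mem le_rfl)) := by
  rw [← h.pieceBasis_apply (d i) ⟨i, rfl⟩]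
  exact (Module.Basis.reindex_apply (M := ⨁ n, 𝓕.GrPiece n) _ _ i).trans
    (dfinsuppBasis_apply h.pieceBasis (d i) ⟨i, rfl⟩)

end AlgFiltration

/-! ### Base change of bases -/

lemma isBaseChange_of_basis {D k M N ι : Type*} [CommRing D] [CommRing k] [Algebra D k]
    [AddCommGroup M] [Module D M] [AddCommGroup N] [Module D N] [Module k N] [IsScalarTower D k N]
    (f : M →ₗ[D] N) (b : Module.Basis ι D M) (c : Module.Basis ι k N) (h : ∀ i, f (b i) = c i) :
    IsBaseChange k f := by
  have hf : f = ((Finsupp.linearCombination D c).restrictScalars D).comp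
      (b.repr : M →ₗ[D] ι →₀ D) := by
    refine b.ext fun i => ?_
    simp [h]
  rw [hf]
  exact (IsBaseChange.ofEquiv b.repr).comp (IsBaseChange.of_basis D c)

/-- Coordinates are unchanged by passing from `D` to `k`. Injectivity, and the comparison of the
induced filtration with the original one, follow from this. -/
lemma repr_of_map_basis {D k M N ι : Type*} [CommRing D] [CommRing k] [Algebra D k]
    [AddCommGroup M] [Module D M] [AddCommGroup N] [Module D N] [Module k N] [IsScalarTower D k N]
    (f : M →ₗ[D] N) (b : Module.Basis ι D M) (c : Module.Basis ι k N) (h : ∀ i, f (b i) = c i)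
    (m : M) (i : ι) : c.repr (f m) i = algebraMap D k (b.repr m i) := by
  have : (Finsupp.lapply i).comp ((c.repr.toLinearMap.restrictScalars D).comp f) =
      (Algebra.linearMap D k).comp ((Finsupp.lapply i).comp b.repr.toLinearMap) := by
    refine b.ext fun j => ?_
    by_cases hij : j = i <;> simp [h, hij]
  exact congrArg (fun g => g m) this

lemma injective_of_map_basis {D k M N ι : Type*} [CommRing D] [CommRing k] [Algebra D k]
    [AddCommGroup M] [Module D M] [AddCommGroup N] [Module D N] [Module k N] [IsScalarTower D k N]
    (hDk : Function.Injective (algebraMap D k))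
    (f : M →ₗ[D] N) (b : Module.Basis ι D M) (c : Module.Basis ι k N) (h : ∀ i, f (b i) = c i) :
    Function.Injective f := by
  refine (injective_iff_map_eq_zero f).2 fun m hm => b.repr.map_eq_zero_iff.1 (Finsupp.ext fun i => ?_)
  have := repr_of_map_basis f b c h m i
  rw [hm, map_zero, Finsupp.zero_apply, eq_comm, map_eq_zero_iff _ hDk] at this
  exact this

/-! ### The associated graded algebra of a filtration by words -/

namespace AlgFiltration

variable {R A : Type*} [CommRing R] [Ring A] [Algebra R A] (𝓕 : AlgFiltration R A)

lemma grOf_symbol_congr {i j : ℕ} (hij : i = j) {a b : A} (hab : a = b) (ha : a ∈ 𝓕.F i)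
    (hb : b ∈ 𝓕.F j) : 𝓕.grOf i (𝓕.symbol i a ha) = 𝓕.grOf j (𝓕.symbol j b hb) := by
  subst hij
  subst hab
  rfl

variable {n : ℕ} {x : Fin n → A}

/-- The filtration whose step `F m` is spanned by the words of length at most `m` in `x`. -/
def IsWordFiltration (x : Fin n → A) : Prop := ∀ m, 𝓕.F m = wordSpan R x (m + 1)

variable {𝓕}

lemma IsWordFiltration.prev_eq (h : 𝓕.IsWordFiltration x) (m : ℕ) :
    𝓕.prev m = wordSpan R x m := by
  cases m with
  | zero => simp [prev, wordSpan]
  | succ m => exact h m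

lemma IsWordFiltration.wordProd_mem (h : 𝓕.IsWordFiltration x) (l : List (Fin n)) :
    wordProd x l ∈ 𝓕.F l.length := by
  rw [h]
  exact wordProd_mem_wordSpan x (Nat.lt_succ_self _)

lemma IsWordFiltration.gen_mem (h : 𝓕.IsWordFiltration x) (i : Fin n) : x i ∈ 𝓕.F 1 := by
  simpa [wordProd] using h.wordProd_mem [i]

/-- The symbols of the generators. -/
def IsWordFiltration.grGen (h : 𝓕.IsWordFiltration x) (i : Fin n) : 𝓕.Gr :=
  𝓕.grOf 1 (𝓕.symbol 1 (x i) (h.gen_mem i))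

lemma IsWordFiltration.wordProd_grGen (h : 𝓕.IsWordFiltration x) (l : List (Fin n)) :
    wordProd h.grGen l = 𝓕.grOf l.length (𝓕.symbol l.length (wordProd x l) (h.wordProd_mem l)) := by
  induction l with
  | nil => rfl
  | cons i l ih =>
    rw [wordProd_cons, ih, grGen, grOf_symbol_mul]
    exact 𝓕.grOf_symbol_congr (by simp [add_comm]) (wordProd_cons x i l).symm _ _

/-- The correction term is linear, so it lies in the step before degree 2 and vanishes in the graded
algebra. -/
lemma IsWordFiltration.grGen_mul (h : 𝓕.IsWordFiltration x) (H : SignCommuting R x)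
    (i j : Fin n) : ∃ s : ℤˣ, h.grGen i * h.grGen j = s • (h.grGen j * h.grGen i) := by
  obtain ⟨s, hs⟩ := H i j
  refine ⟨s, ?_⟩
  have hij := 𝓕.mul_mem (h.gen_mem i) (h.gen_mem j)
  have hji := 𝓕.mul_mem (h.gen_mem j) (h.gen_mem i)
  have h0 : 𝓕.symbol (1 + 1) (x i * x j) hij - (s : ℤ) • 𝓕.symbol (1 + 1) (x j * x i) hji = 0 := by
    have hs' : x i * x j - (s : ℤ) • (x j * x i) ∈ 𝓕.prev (1 + 1) := by
      rw [h.prev_eq]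
      exact span_range_le_wordSpan x hs
    exact 𝓕.symbol_eq_zero (ha := 𝓕.prev_le _ hs') |>.2 hs'
  rw [grGen, grGen, grOf_symbol_mul, grOf_symbol_mul, sub_eq_zero.1 h0, Units.smul_def, map_zsmul]

lemma IsWordFiltration.grBasis_eq (h : 𝓕.IsWordFiltration x) {N : Set (Fin n →₀ ℕ)}
    {b : Module.Basis N R A} (hb : 𝓕.Adapted b fun e => (e : Fin n →₀ ℕ).degree)
    (hbx : ∀ e, b e = monoProd x (e : Fin n →₀ ℕ)) (e : N) :
    hb.grBasis e = monoProd h.grGen (e : Fin n →₀ ℕ) := by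
  rw [hb.grBasis_apply, monoProd, h.wordProd_grGen]
  exact 𝓕.grOf_symbol_congr (length_expList _).symm (hbx e) _ _

end AlgFiltration

/-! ### Algebras which are finite over a central subalgebra -/

section Finite

open Polynomial

lemma isTwoSidedNoetherian_of_finite (Z S : Type*) [CommRing Z] [IsNoetherianRing Z] [Ring S]
    [Algebra Z S] [Module.Finite Z S] : IsTwoSidedNoetherian S := by
  have h : IsNoetherian Z S := inferInstance
  have : Module.Finite Z Sᵐᵒᵖ := Module.Finite.equiv (MulOpposite.opLinearEquiv Z)
  exact ⟨isNoetherian_of_tower Z h, isNoetherian_of_tower Z (inferInstance : IsNoetherian Z Sᵐᵒᵖ)⟩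

variable {R S : Type*} [CommRing R] [Ring S] [Algebra R S] {n : ℕ} {x : Fin n → S}

lemma commute_of_commute_gen (hspan : Submodule.span R (Set.range (monoProd x)) = ⊤) {z : S}
    (hz : ∀ i, Commute z (x i)) (y : S) : Commute z y := by
  have hy : y ∈ Submodule.span R (Set.range (monoProd x)) := hspan ▸ Submodule.mem_top
  induction hy using Submodule.span_induction with
  | mem y hy =>
    obtain ⟨e, rfl⟩ := hy
    refine Commute.list_prod_right _ _ fun a ha => ?_
    obtain ⟨i, -, rfl⟩ := List.mem_map.1 ha
    exact hz i
  | zero => exact Commute.zero_right z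
  | add a b _ _ ha hb => exact ha.add_right hb
  | smul r a _ ha => exact ha.smul_right r

/-- Each factor is finite by integrality, and products of finitely generated submodules are finitely
generated. No commutation between different `x i` is used. -/
lemma fg_prod_adjoin {P : Type*} [CommRing P] [Algebra P S] (hx : ∀ i, IsIntegral P (x i))
    (L : List (Fin n)) :
    (L.map fun i => Subalgebra.toSubmodule (Algebra.adjoin P {x i})).prod.FG := by
  induction L with
  | nil =>
    rw [List.map_nil, List.prod_nil, Submodule.one_eq_span]
    exact Submodule.fg_span_singleton 1
  | cons i L ih =>
    rw [List.map_cons, List.prod_cons]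
    exact (hx i).fg_adjoin_singleton.mul ih

lemma monoProd_mem_prod_adjoin (P : Type*) [CommRing P] [Algebra P S] (x : Fin n → S)
    (e : Fin n →₀ ℕ) : monoProd x e ∈
      ((List.finRange n).map fun i => Subalgebra.toSubmodule (Algebra.adjoin P {x i})).prod := by
  rw [monoProd, expList]
  generalize List.finRange n = L
  induction L with
  | nil => exact Submodule.one_le.1 le_rfl
  | cons i L ih =>
    rw [List.flatMap_cons, wordProd_append, List.map_cons, List.prod_cons]
    refine Submodule.mul_mem_mul ?_ ih
    rw [wordProd, List.map_replicate, List.prod_replicate, Subalgebra.mem_toSubmodule]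
    exact pow_mem (Algebra.self_mem_adjoin_singleton P (x i)) _

/-- If the ordered monomials in `x` span `S` and each `x i` has a monic polynomial with central
value, then `S` is finite over a polynomial ring acting through central elements. -/
lemma exists_finite_mvPolynomial (hspan : Submodule.span R (Set.range (monoProd x)) = ⊤)
    (p : Fin n → R[X]) (hp : ∀ i, (p i).Monic) (hp' : ∀ i, 0 < (p i).natDegree)
    (hc : ∀ i j, Commute (aeval (x i) (p i)) (x j)) :
    ∃ _ : Algebra (MvPolynomial (Fin n) R) S, IsScalarTower R (MvPolynomial (Fin n) R) S ∧
      Module.Finite (MvPolynomial (Fin n) R) S := by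
  have hz : ∀ i, aeval (x i) (p i) ∈ Subalgebra.center R S := fun i =>
    Subalgebra.mem_center_iff.2 fun y => (commute_of_commute_gen hspan (hc i) y).eq.symm
  let f : MvPolynomial (Fin n) R →ₐ[R] S := (Subalgebra.center R S).val.comp
    (MvPolynomial.aeval fun i => (⟨_, hz i⟩ : Subalgebra.center R S))
  have hfX : ∀ i, f (MvPolynomial.X i) = aeval (x i) (p i) := fun i => by simp [f]
  let alg : Algebra (MvPolynomial (Fin n) R) S := f.toRingHom.toAlgebra' fun c y =>
    (Subalgebra.mem_center_iff.1 (MvPolynomial.aeval _ c : Subalgebra.center R S).2 y).symm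
  have hmap : ∀ c, algebraMap (MvPolynomial (Fin n) R) S c = f c := fun _ => rfl
  have tower : IsScalarTower R (MvPolynomial (Fin n) R) S :=
    IsScalarTower.of_algebraMap_eq fun r => (f.commutes r).symm
  have hint : ∀ i, IsIntegral (MvPolynomial (Fin n) R) (x i) := fun i => by
    nontriviality R
    -- The polynomial `p i - X i` in a new variable kills `x i`, since `X i` acts as the value of `p
    -- i` at `x i`. It stays monic because `p i` has positive degree.
    refine ⟨(p i).map (algebraMap R _) - C (MvPolynomial.X i), ((hp i).map _).sub_of_left ?_, ?_⟩
    · refine lt_of_le_of_lt degree_C_le ?_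
      rw [(hp i).degree_map]
      exact natDegree_pos_iff_degree_pos.1 (hp' i)
    · rw [eval₂_sub, eval₂_C, hmap, hfX, ← aeval_def, aeval_map_algebraMap, sub_self]
  refine ⟨alg, tower, ⟨?_⟩⟩
  -- The product of the subalgebras generated by single `x i`, taken in increasing order, contains
  -- every ordered monomial.
  suffices h : ((List.finRange n).map fun i => Subalgebra.toSubmodule
      (Algebra.adjoin (MvPolynomial (Fin n) R) {x i})).prod = ⊤ from
    h ▸ fg_prod_adjoin hint (List.finRange n)
  refine eq_top_iff.2 fun y _ => ?_
  have hy : y ∈ Submodule.span R (Set.range (monoProd x)) := hspan ▸ Submodule.mem_top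
  refine (Submodule.span_le (R := MvPolynomial (Fin n) R)).2 ?_
    (Submodule.span_le_restrictScalars R (MvPolynomial (Fin n) R) _ hy)
  rintro _ ⟨e, rfl⟩
  exact monoProd_mem_prod_adjoin _ x e

lemma span_monoProd_tensor (C : Type*) [CommRing C] [Algebra R C]
    (hspan : Submodule.span R (Set.range (monoProd x)) = ⊤) :
    Submodule.span C (Set.range (monoProd fun i => (1 : C) ⊗ₜ[R] x i)) = ⊤ := by
  refine (Submodule.eq_top_iff').2 fun y => ?_
  induction y using TensorProduct.induction_on with
  | zero => exact zero_mem _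
  | add a b ha hb => exact add_mem ha hb
  | tmul c s =>
    have hs : s ∈ Submodule.span R (Set.range (monoProd x)) := hspan ▸ Submodule.mem_top
    have h1 : (1 : C) ⊗ₜ[R] s ∈
        Submodule.span C (Set.range (monoProd fun i => (1 : C) ⊗ₜ[R] x i)) := by
      induction hs using Submodule.span_induction with
      | mem s hs =>
        obtain ⟨e, rfl⟩ := hs
        refine Submodule.subset_span ⟨e, ?_⟩
        exact (map_wordProd (Algebra.TensorProduct.includeRight : S →ₐ[R] C ⊗[R] S).toRingHom
          x _).symm
      | zero =>
        rw [TensorProduct.tmul_zero]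
        exact zero_mem _
      | add a b _ _ ha hb =>
        rw [TensorProduct.tmul_add]
        exact add_mem ha hb
      | smul r a _ ha =>
        rw [TensorProduct.tmul_smul, ← algebraMap_smul C r]
        exact Submodule.smul_mem _ _ ha
    have := Submodule.smul_mem _ c h1
    rwa [TensorProduct.smul_tmul', smul_eq_mul, mul_one] at this

lemma isTwoSidedNoetherian_of_ringEquiv {S T : Type*} [Ring S] [Ring T] (e : S ≃+* T)
    (h : IsTwoSidedNoetherian S) : IsTwoSidedNoetherian T := by
  obtain ⟨h1, h2⟩ := h
  exact ⟨isNoetherianRing_of_ringEquiv S e, isNoetherianRing_of_ringEquiv Sᵐᵒᵖ e.op⟩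

lemma isTwoSidedNoetherian_of_subsingleton (S : Type*) [Ring S] [Subsingleton S] :
    IsTwoSidedNoetherian S :=
  ⟨inferInstance, inferInstance⟩

/-- An algebra spanned by ordered monomials in generators which commute up to signs is strongly
noetherian. -/
lemma isStronglyNoetherian_of_sign_commute
    (hspan : Submodule.span R (Set.range (monoProd x)) = ⊤)
    (hx : ∀ i j, ∃ s : ℤˣ, x i * x j = s • (x j * x i)) : IsStronglyNoetherian.{_, _, w} R S := by
  intro C _ _ _
  refine isTwoSidedNoetherian_of_ringEquiv
    (Algebra.TensorProduct.comm R C S).toRingEquiv ?_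
  -- Moving `x j` past two copies of `x i` produces the same sign twice.
  have hsq : ∀ i j, Commute (x i ^ 2) (x j) := fun i j => by
    obtain ⟨s, hs⟩ := hx i j
    have h1 : x i * x i * x j = s • s • (x j * (x i * x i)) := by
      rw [mul_assoc, hs, mul_smul_comm, ← mul_assoc, hs, smul_mul_assoc, mul_assoc]
    rw [smul_smul, Int.units_mul_self, one_smul] at h1
    rw [sq]
    exact h1
  -- Over the zero ring `X ^ 2` has `natDegree` 0, so that case is separate.
  rcases subsingleton_or_nontrivial C with hC | hC
  · have : Subsingleton (C ⊗[R] S) := Module.subsingleton C _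
    exact isTwoSidedNoetherian_of_subsingleton _
  · obtain ⟨_, _, _⟩ := exists_finite_mvPolynomial (span_monoProd_tensor C hspan)
      (fun _ => X ^ 2) (fun _ => monic_X_pow 2) (fun _ => by simp) (fun i j => by
        have := (hsq i j).map (Algebra.TensorProduct.includeRight : S →ₐ[R] C ⊗[R] S)
        simpa using this)
    exact isTwoSidedNoetherian_of_finite (MvPolynomial (Fin n) C) _

end Finite

/-! ### Polynomial identities -/

section PI

/-- The standard polynomial of degree `m`, in the free algebra. -/
def standardPoly (K : Type*) [Field K] (m : ℕ) : FreeAlgebra K ℕ :=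
  ∑ σ : Equiv.Perm (Fin m), (Equiv.Perm.sign σ : ℤ) •
    (List.ofFn fun i => FreeAlgebra.ι K ((σ i : Fin m) : ℕ)).prod

lemma lift_of_list_prod (K : Type*) [Field K] (l : List ℕ) :
    FreeAlgebra.lift K (fun i => MonoidAlgebra.of K (FreeMonoid ℕ) (FreeMonoid.of i))
      (l.map (FreeAlgebra.ι K)).prod = MonoidAlgebra.of K (FreeMonoid ℕ) (FreeMonoid.ofList l) := by
  induction l with
  | nil => simp [MonoidAlgebra.one_def]
  | cons i l ih =>
    rw [List.map_cons, List.prod_cons, map_mul, ih, FreeAlgebra.lift_ι_apply, FreeMonoid.ofList_cons,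
      map_mul]

/-- Distinct permutations give distinct words, so in the monoid algebra of the free monoid the word
of the identity has coefficient 1. -/
lemma standardPoly_ne_zero (K : Type*) [Field K] (m : ℕ) : standardPoly K m ≠ 0 := by
  intro h
  let w : Equiv.Perm (Fin m) → FreeMonoid ℕ := fun σ =>
    FreeMonoid.ofList (List.ofFn fun i => ((σ i : Fin m) : ℕ))
  have hw : ∀ σ, w σ = w 1 ↔ σ = 1 := fun σ => by
    refine ⟨fun h => ?_, fun h => by rw [h]⟩
    have h' := List.ofFn_injective (FreeMonoid.ofList.injective h)
    exact Equiv.ext fun i => Fin.ext (congrFun h' i)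
  have h1 := congrArg (FreeAlgebra.lift K
    (fun i => MonoidAlgebra.of K (FreeMonoid ℕ) (FreeMonoid.of i))) h
  have h2 : ∀ σ : Equiv.Perm (Fin m), FreeAlgebra.lift K
      (fun i => MonoidAlgebra.of K (FreeMonoid ℕ) (FreeMonoid.of i))
      (List.ofFn fun i => FreeAlgebra.ι K ((σ i : Fin m) : ℕ)).prod =
      MonoidAlgebra.single (w σ) 1 := by
    intro σ
    rw [← MonoidAlgebra.of_apply, ← lift_of_list_prod, List.map_ofFn]
    rfl
  simp only [standardPoly, map_sum, map_zsmul, h2, map_zero] at h1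
  have h3 := congrArg ((Finsupp.applyAddHom (w 1)).comp
    (MonoidAlgebra.coeffAddEquiv (R := K) (M := FreeMonoid ℕ)).toAddMonoidHom) h1
  rw [map_sum, map_zero] at h3
  classical
  simp [Finsupp.single_apply, hw] at h3

variable {Z S : Type*} [CommRing Z] [Ring S] [Algebra Z S]

/-- Pull back along the surjection from the free module of rank `d`. There an alternating map is
determined by its values on `m` distinct basis vectors, and there are too few of them. -/
lemma alternating_eq_zero_of_span {d m : ℕ} (hdm : d < m) {N : Type*} [AddCommGroup N] [Module Z N]
    (g : Fin d → S) (hg : Submodule.span Z (Set.range g) = ⊤) (f : S [⋀^Fin m]→ₗ[Z] N) :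
    f = 0 := by
  have hsurj : Function.Surjective (Fintype.linearCombination Z g) := by
    rw [← LinearMap.range_eq_top, Fintype.range_linearCombination, hg]
  have h : f.compLinearMap (Fintype.linearCombination Z g) = 0 := by
    refine Module.Basis.ext_alternating (Pi.basisFun Z (Fin d)) fun v hv => ?_
    have := Fintype.card_le_of_injective v hv
    simp at this
    omega
  ext s
  choose t ht using fun i => hsurj (s i)
  have := congrArg (fun F => F t) h
  simpa [ht] using this

lemma sum_sign_prod_eq_zero [Module.Finite Z S] :
    ∃ m : ℕ, ∀ s : Fin m → S,
      ∑ σ : Equiv.Perm (Fin m), (Equiv.Perm.sign σ : ℤ) • (List.ofFn fun i => s (σ i)).prod = 0 := by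
  obtain ⟨d, g, hg⟩ := Module.Finite.exists_fin (R := Z) (M := S)
  refine ⟨d + 1, fun s => ?_⟩
  -- The standard polynomial is the alternatization of the `Z`-multilinear product.
  have h := congrArg (fun F => F s) (alternating_eq_zero_of_span (Nat.lt_succ_self d) g hg
    (MultilinearMap.alternatization (MultilinearMap.mkPiAlgebraFin Z (d + 1) S)))
  simpa [MultilinearMap.alternatization_apply, Units.smul_def] using h

lemma isPIAlgebra_of_finite (K : Type*) [Field K] [Algebra K S] (Z : Type*) [CommRing Z]
    [Algebra Z S] [Module.Finite Z S] : IsPIAlgebra K S := by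
  obtain ⟨m, hm⟩ := sum_sign_prod_eq_zero (Z := Z) (S := S)
  refine ⟨standardPoly K m, standardPoly_ne_zero K m, fun s => ?_⟩
  rw [standardPoly, map_sum, ← hm fun i => s i]
  refine Finset.sum_congr rfl fun σ _ => ?_
  rw [map_zsmul, map_list_prod, List.map_ofFn]
  simp [Function.comp_def]

end PI

/-! ### Finite base fields -/

section FiniteField

open Polynomial

variable {K S : Type*} [Field K] [Ring S] [Algebra K S] {n : ℕ} {x : Fin n → S}

/-- Over a finite field, an element which normalizes a finite-dimensional space under commutators
has a difference of `p`-power powers commuting with that space. -/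
lemma exists_commute_pow_sub_pow [Finite K] {p : ℕ} [Fact p.Prime] [CharP K p] (V : Submodule K S)
    [Module.Finite K V] {u : S} (hu : ∀ v ∈ V, u * v - v * u ∈ V) :
    ∃ a b : ℕ, a < b ∧ ∀ v ∈ V, Commute (u ^ p ^ b - u ^ p ^ a) v := by
  rcases subsingleton_or_nontrivial S with hS | hS
  · exact ⟨0, 1, Nat.zero_lt_one, fun v _ => Subsingleton.elim _ _⟩
  have : Finite V := Module.finite_of_finite K
  have : CharP (Module.End K S) p := charP_of_injective_algebraMap
    (algebraMap K (Module.End K S)).injective p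
  let δ : Module.End K S := LinearMap.mulLeft K u - LinearMap.mulRight K u
  have hmem : ∀ m, ∀ v ∈ V, (δ ^ m) v ∈ V := by
    intro m
    induction m with
    | zero => exact fun v hv => hv
    | succ m ih =>
      intro v hv
      rw [pow_succ, Module.End.mul_apply]
      exact ih _ (hu v hv)
  -- Left and right multiplication by `u` commute, so in characteristic `p` the power `p ^ m`
  -- distributes over their difference.
  have hpow : ∀ m v, (δ ^ p ^ m) v = u ^ p ^ m * v - v * u ^ p ^ m := by
    intro m v
    rw [sub_pow_char_pow_of_commute _ _ (LinearMap.commute_mulLeft_right u u),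
      LinearMap.pow_mulLeft, LinearMap.pow_mulRight]
    rfl
  let F : ℕ → V → V := fun m v => ⟨(δ ^ p ^ m) v, hmem _ v v.2⟩
  -- Pigeonhole: `V` is a finite set and has only finitely many self-maps.
  obtain ⟨a, b, hne, hab⟩ := Finite.exists_ne_map_eq_of_infinite F
  wlog hlt : a < b generalizing a b
  · exact this b a hne.symm hab.symm (lt_of_le_of_ne (not_lt.1 hlt) hne.symm)
  refine ⟨a, b, hlt, fun v hv => ?_⟩
  have h1 : (δ ^ p ^ a) v = (δ ^ p ^ b) v := congrArg Subtype.val (congrFun hab ⟨v, hv⟩)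
  rw [hpow, hpow] at h1
  rw [Commute, SemiconjBy, sub_mul, mul_sub, sub_eq_sub_iff_sub_eq_sub, h1]

lemma finite_over_central [Finite K] (hspan : Submodule.span K (Set.range (monoProd x)) = ⊤)
    (hx : PowerNormalizing K x) :
    ∃ _ : Algebra (MvPolynomial (Fin n) K) S, IsScalarTower K (MvPolynomial (Fin n) K) S ∧
      Module.Finite (MvPolynomial (Fin n) K) S := by
  obtain ⟨p, hp⟩ := CharP.exists K
  have : Fact p.Prime := ⟨(CharP.char_is_prime_or_zero K p).resolve_right
    (CharP.char_ne_zero_of_finite K p)⟩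
  have hp1 := (Fact.out : p.Prime).one_lt
  choose r hr hrx using hx
  have hfin : Module.Finite K (Submodule.span K (Set.range x)) :=
    Module.Finite.span_of_finite K (Set.finite_range x)
  have hnorm : ∀ i, ∀ v ∈ Submodule.span K (Set.range x),
      x i ^ r i * v - v * x i ^ r i ∈ Submodule.span K (Set.range x) := by
    intro i v hv
    have h : Submodule.span K (Set.range x) ≤ (Submodule.span K (Set.range x)).comap
        (LinearMap.mulLeft K (x i ^ r i) - LinearMap.mulRight K (x i ^ r i)) := by
      refine Submodule.span_le.2 ?_
      rintro _ ⟨j, rfl⟩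
      exact hrx i j
    exact h hv
  choose a b hab hcomm using fun i => exists_commute_pow_sub_pow (p := p) _ (hnorm i)
  have hlt : ∀ i, r i * p ^ a i < r i * p ^ b i := fun i =>
    Nat.mul_lt_mul_of_pos_left (Nat.pow_lt_pow_right hp1 (hab i)) (hr i)
  refine exists_finite_mvPolynomial hspan
    -- At `x i` this takes the value `u ^ p ^ b - u ^ p ^ a` with `u = x i ^ r`, which commutes with
    -- all generators.
    (fun i => X ^ (r i * p ^ b i) - X ^ (r i * p ^ a i)) (fun i => ?_) (fun i => ?_)
    (fun i j => ?_)
  · refine (monic_X_pow _).sub_of_left ?_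
    rw [degree_X_pow, degree_X_pow]
    exact_mod_cast hlt i
  · rw [natDegree_sub_eq_left_of_natDegree_lt (by simpa using hlt i), natDegree_X_pow]
    exact lt_of_le_of_lt (Nat.zero_le _) (hlt i)
  · have := hcomm i (x j) (Submodule.subset_span ⟨j, rfl⟩)
    simpa [pow_mul] using this

lemma finiteType_of_span_monoProd (hspan : Submodule.span K (Set.range (monoProd x)) = ⊤) :
    Algebra.FiniteType K S := by
  classical
  refine ⟨⟨Finset.univ.image x, ?_⟩⟩
  rw [Finset.coe_image, Finset.coe_univ, Set.image_univ, ← Algebra.toSubmodule_eq_top,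
    eq_top_iff, ← hspan, Submodule.span_le]
  rintro _ ⟨e, rfl⟩
  refine Subalgebra.list_prod_mem _ fun a ha => ?_
  obtain ⟨i, -, rfl⟩ := List.mem_map.1 ha
  exact Algebra.subset_adjoin ⟨i, rfl⟩

lemma PowerNormalizing.tensor {R T : Type*} [CommRing R] [Ring T] [Algebra R T] {y : Fin n → T}
    (H : PowerNormalizing R y) (C : Type*) [CommRing C] [Algebra R C] :
    PowerNormalizing C fun i => (1 : C) ⊗ₜ[R] y i := by
  intro i
  obtain ⟨r, hr, h⟩ := H i
  refine ⟨r, hr, fun j => ?_⟩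
  have h1 : Submodule.span R (Set.range y) ≤ ((Submodule.span C
      (Set.range fun i => (1 : C) ⊗ₜ[R] y i)).restrictScalars R).comap
        (Algebra.TensorProduct.includeRight : T →ₐ[R] C ⊗[R] T).toLinearMap := by
    refine Submodule.span_le.2 ?_
    rintro _ ⟨l, rfl⟩
    exact Submodule.subset_span ⟨l, rfl⟩
  have h2 : (1 : C) ⊗ₜ[R] (y i ^ r * y j - y j * y i ^ r) ∈
    Submodule.span C (Set.range fun i => (1 : C) ⊗ₜ[R] y i) := h1 (h j)
  simpa [TensorProduct.tmul_sub, Algebra.TensorProduct.tmul_pow] using h2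

end FiniteField

/-! ### Congeniality of algebras filtered by words -/

section Main

lemma span_monoProd_univ {R A : Type*} [CommRing R] [Ring A] [Algebra R A] {n : ℕ} {x : Fin n → A}
    {N : Set (Fin n →₀ ℕ)}
    (h : Submodule.span R (Set.range fun e : N => monoProd x (e : Fin n →₀ ℕ)) = ⊤) :
    Submodule.span R (Set.range (monoProd x)) = ⊤ := by
  refine eq_top_iff.2 (h ▸ Submodule.span_mono ?_)
  rintro _ ⟨e, rfl⟩
  exact ⟨e, rfl⟩

lemma adjoin_gen_eq_top {R A : Type*} [CommRing R] [Ring A] [Algebra R A] {n : ℕ} (x : Fin n → A) :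
    Algebra.adjoin R (Set.range fun i =>
      (⟨x i, Algebra.subset_adjoin ⟨i, rfl⟩⟩ : Algebra.adjoin R (Set.range x))) = ⊤ := by
  rw [← Algebra.adjoin_adjoin_coe_preimage (R := R) (s := Set.range x)]
  congr 1
  ext b
  exact ⟨fun ⟨i, hi⟩ => ⟨i, congrArg Subtype.val hi⟩, fun ⟨i, hi⟩ => ⟨i, Subtype.ext hi⟩⟩

variable {k : Type u} {A : Type v} [Field k] [Ring A] [Algebra k A] {n : ℕ}

lemma AlgFiltration.IsWordFiltration.exists_adapted_basis {𝓕 : AlgFiltration k A} {x : Fin n → A}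
    (hF : 𝓕.IsWordFiltration x) (H : SignCommuting k x) :
    ∃ b : Module.Basis (normalExp k x) k A, (∀ e, b e = monoProd x (e : Fin n →₀ ℕ)) ∧
      𝓕.Adapted b fun e => (e : Fin n →₀ ℕ).degree := by
  have hgen : ∀ a, ∃ d, a ∈ wordSpan k x d := fun a => by
    obtain ⟨m, hm⟩ := 𝓕.exhaustive a
    exact ⟨m + 1, hF m ▸ hm⟩
  have hred : ∀ e ∉ normalExp k x, monoProd x e ∈ lowerSpan k x e := fun e he => not_not.1 he
  let b : Module.Basis (normalExp k x) k A := Module.Basis.mk (linearIndependent_normal x)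
    (span_monoProd_eq_top hgen H hred).ge
  have hb : ∀ e, b e = monoProd x (e : Fin n →₀ ℕ) := fun e => Module.Basis.mk_apply _ _ e
  refine ⟨b, hb, fun m => ?_⟩
  rw [hF, span_image_eq_wordSpan H hred, funext hb]

variable {D : Type u} [CommRing D] [Algebra D k] [Algebra D A] [IsScalarTower D k A]

/-- Independence over `D` is inherited from `k`, while spanning needs the reductions to have
coefficients in `D`. Normality is taken over `k`, so both bases have the same index set. -/
lemma exists_basis_of_reduction (hDk : Function.Injective (algebraMap D k)) {B : Subalgebra D A}
    {y : Fin n → B} (hy : ∀ b, ∃ d, b ∈ wordSpan D y d)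
    (H : SignCommuting D fun i => (y i : A))
    (hred : ∀ e ∉ normalExp k fun i => (y i : A), monoProd (fun i => (y i : A)) e ∈
      lowerSpan D (fun i => (y i : A)) e) :
    ∃ b : Module.Basis (normalExp k fun i => (y i : A)) D B,
      (∀ e, b e = monoProd y (e : Fin n →₀ ℕ)) ∧
      ∀ m, wordSpan D y (m + 1) =
        Submodule.span D (b '' {e | (e : Fin n →₀ ℕ).degree ≤ m}) := by
  have hB : Function.Injective B.val := Subtype.val_injective
  have HB : SignCommuting D y := SignCommuting.of_injective hB H
  have hval : ∀ e, B.val (monoProd y e) = monoProd (fun i => (y i : A)) e :=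
    fun e => map_monoProd (B.val : B →+* A) y e
  have hredB : ∀ e ∉ normalExp k fun i => (y i : A), monoProd y e ∈ lowerSpan D y e := by
    intro e he
    refine (Function.Injective.mem_set_image (f := B.val.toLinearMap) hB).1 ?_
    rw [← Submodule.map_coe, SetLike.mem_coe, map_lowerSpan, AlgHom.toLinearMap_apply, hval]
    exact hred e he
  have hli : LinearIndependent D fun e : normalExp k fun i => (y i : A) =>
      monoProd y (e : Fin n →₀ ℕ) := by
    refine LinearIndependent.of_comp B.val.toLinearMap ?_
    have h := (linearIndependent_normal (K := k) fun i => (y i : A)).restrict_scalars (R := D)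
      (by simpa [Algebra.smul_def] using hDk)
    have he : B.val.toLinearMap ∘ (fun e : normalExp k fun i => (y i : A) =>
        monoProd y (e : Fin n →₀ ℕ)) = fun e : normalExp k fun i => (y i : A) =>
          monoProd (fun i => (y i : A)) (e : Fin n →₀ ℕ) :=
      funext fun e => hval e
    rw [he]
    exact h
  let b : Module.Basis (normalExp k fun i => (y i : A)) D B :=
    Module.Basis.mk hli (span_monoProd_eq_top hy HB hredB).ge
  have hb : ∀ e, b e = monoProd y (e : Fin n →₀ ℕ) := fun e => Module.Basis.mk_apply _ _ e
  refine ⟨b, hb, fun m => ?_⟩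
  rw [span_image_eq_wordSpan HB hredB, funext hb]

/-- An element of `B` has the same support in both bases, so its filtration degree can be read off
over `D`. -/
lemma AlgFiltration.Adapted.induced {𝓕 : AlgFiltration k A} {ι : Type*} {c : Module.Basis ι k A}
    {d : ι → ℕ} (h : 𝓕.Adapted c d) (hDk : Function.Injective (algebraMap D k))
    {B : Subalgebra D A} (b : Module.Basis ι D B) (hbc : ∀ i, B.val.toLinearMap (b i) = c i) :
    (𝓕.induced D B).Adapted b d := fun m => by
  ext a
  have h1 : a ∈ (𝓕.induced D B).F m ↔ B.val.toLinearMap a ∈ 𝓕.F m := Iff.rfl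
  rw [h1, h, Module.Basis.mem_span_image, Module.Basis.mem_span_image]
  have h2 : (c.repr (B.val.toLinearMap a)).support = (b.repr a).support := by
    ext i
    rw [Finsupp.mem_support_iff, Finsupp.mem_support_iff, repr_of_map_basis _ b c hbc,
      map_ne_zero_iff _ hDk]
  rw [h2]

lemma AlgFiltration.Adapted.grMap_grBasis {𝓕 : AlgFiltration k A} [Algebra D 𝓕.Gr]
    [IsScalarTower D k 𝓕.Gr] {ι : Type*} {c : Module.Basis ι k A} {d : ι → ℕ}
    (hc : 𝓕.Adapted c d) {B : Subalgebra D A} {b : Module.Basis ι D B}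
    (hb : (𝓕.induced D B).Adapted b d) (hbc : ∀ i, B.val.toLinearMap (b i) = c i) (i : ι) :
    (𝓕.grMap D B).toLinearMap (hb.grBasis i) = hc.grBasis i := by
  rw [hc.grBasis_apply, hb.grBasis_apply]
  refine (DirectSum.toModule_lof D _ _).trans ?_
  refine (𝓕.grMapPiece_symbol D B _).trans ?_
  exact 𝓕.grOf_symbol_congr rfl (hbc i) _ _

lemma finiteType_noetherian_pi_tensor {B : Type*} [Ring B] [Algebra D B] {y : Fin n → B}
    (hspan : Submodule.span D (Set.range (monoProd y)) = ⊤) (H : PowerNormalizing D y)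
    (K : Type*) [Field K] [Finite K] [Algebra D K] :
    Algebra.FiniteType K (K ⊗[D] B) ∧ IsTwoSidedNoetherian (K ⊗[D] B) ∧
      IsPIAlgebra K (K ⊗[D] B) := by
  have hspanK := span_monoProd_tensor K hspan
  obtain ⟨_, _, _⟩ := finite_over_central hspanK (H.tensor K)
  exact ⟨finiteType_of_span_monoProd hspanK,
    isTwoSidedNoetherian_of_finite (MvPolynomial (Fin n) K) _,
    isPIAlgebra_of_finite _ (MvPolynomial (Fin n) K)⟩

/-- An algebra filtered by the length of words in finitely many generators is congenial if the
generators commute up to signs and linear terms, and a power of each of them normalizes their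
span. -/
theorem isCongenial_of_isWordFiltration (𝓕 : AlgFiltration k A) {x : Fin n → A}
    (hF : 𝓕.IsWordFiltration x) (H : SignCommuting k x) (H' : PowerNormalizing k x) :
    IsCongenial.{u, v, w} 𝓕 := by
  obtain ⟨D, hDfg, HD, HD', hred⟩ := exists_fg_coefficients H H'
  have hDk : Function.Injective (algebraMap D k) := Subtype.val_injective
  let B : Subalgebra D A := Algebra.adjoin D (Set.range x)
  let y : Fin n → B := fun i => ⟨x i, Algebra.subset_adjoin ⟨i, rfl⟩⟩
  have hB : Function.Injective B.val := Subtype.val_injective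
  have HB : SignCommuting D y := SignCommuting.of_injective hB HD
  have HB' : PowerNormalizing D y := PowerNormalizing.of_injective hB HD'
  obtain ⟨c, hcx, hc⟩ := hF.exists_adapted_basis H
  obtain ⟨b, hby, hb⟩ := exists_basis_of_reduction hDk (y := y)
    (exists_mem_wordSpan (adjoin_gen_eq_top x)) HD hred
  have hbc : ∀ e, B.val.toLinearMap (b e) = c e := fun e => by
    rw [hcx, hby]
    exact map_monoProd (B.val : B →+* A) y e
  have had := hc.induced hDk b hbc
  -- The induced filtration and the word filtration of `B` agree, as both are spanned by the basis
  -- monomials of bounded degree.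
  have hFB : (𝓕.induced D B).IsWordFiltration y := fun m => (had m).trans (hb m).symm
  have hgr := hc.grMap_grBasis had hbc
  have hspanGr : Submodule.span D (Set.range (monoProd hFB.grGen)) = ⊤ := by
    refine span_monoProd_univ (N := normalExp k x) ?_
    rw [← had.grBasis.span_eq]
    exact congrArg (fun g => Submodule.span D (Set.range g))
      (funext fun e => (hFB.grBasis_eq had hby e).symm)
  have hspanB : Submodule.span D (Set.range (monoProd y)) = ⊤ := by
    refine span_monoProd_univ (N := normalExp k x) ?_
    rw [← b.span_eq]
    exact congrArg (fun g => Submodule.span D (Set.range g)) (funext fun e => (hby e).symm)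
  have hdeg : ∀ m, {e : normalExp k x | (e : Fin n →₀ ℕ).degree ≤ m}.Finite := fun m =>
    (Finsupp.finite_of_degree_le m).preimage Subtype.val_injective.injOn
  have hlocB := had.locallyFinite hdeg
  refine ⟨hc.locallyFinite hdeg, D, B, hDfg,
    ⟨hB, Module.Free.of_basis b, isBaseChange_of_basis _ b c hbc⟩, hlocB,
    ⟨injective_of_map_basis hDk _ had.grBasis hc.grBasis hgr, Module.Free.of_basis had.grBasis,
      isBaseChange_of_basis _ had.grBasis hc.grBasis hgr⟩,
    isStronglyNoetherian_of_sign_commute hspanGr (hFB.grGen_mul HB), hlocB.grLocallyFinite, ?_⟩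
  intro I _ _
  let _ : Field (D ⧸ I) := Ideal.Quotient.field I
  exact finiteType_noetherian_pi_tensor hspanB HB' (D ⧸ I)

end Main

/-! ### Enveloping algebras of Lie superalgebras -/

namespace LieSuperalgebra

variable {k : Type u} {L : Type v} [Field k] [AddCommGroup L] [Module k L]
  (S : LieSuperalgebra k L)

lemma exists_homogeneous_basis [Module.Finite k L] :
    ∃ (n : ℕ) (b : Module.Basis (Fin n) k L) (p : Fin n → ZMod 2), ∀ i, b i ∈ S.part (p i) := by
  let b := S.isInternal.collectedBasis fun i => Module.finBasis k (S.part i)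
  let e := Fintype.equivFin (Σ i, Fin (Module.finrank k (S.part i)))
  refine ⟨_, b.reindex e, fun i => (e.symm i).1, fun i => ?_⟩
  rw [Module.Basis.reindex_apply]
  exact S.isInternal.collectedBasis_mem _ _

lemma ι_mul_sub {i j : ZMod 2} {x y : L} (hx : x ∈ S.part i) (hy : y ∈ S.part j) :
    S.ι x * S.ι y - superSign i j • (S.ι y * S.ι x) = S.ι (S.bracket x y) := by
  have h : S.mkEnv _ = S.mkEnv _ := RingQuot.mkAlgHom_rel k (EnvRel.mk hx hy)
  simp only [map_sub, map_zsmul, map_mul] at h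
  exact h

/-- Expanding [x, [x, y]] for odd x, the outer sign is opposite to the inner one, so the two terms
xyx cancel and the square of the sign leaves x²y - yx². -/
lemma ι_sq_mul_sub {j : ZMod 2} {x y : L} (hx : x ∈ S.part 1) (hy : y ∈ S.part j) :
    S.ι x ^ 2 * S.ι y - S.ι y * S.ι x ^ 2 = S.ι (S.bracket x (S.bracket x y)) := by
  have h1 := S.ι_mul_sub hx hy
  have h2 := S.ι_mul_sub hx (S.bracket_mem hx hy)
  have hj : superSign 1 (1 + j) = -superSign 1 j ∧ superSign 1 j * superSign 1 j = 1 := by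
    clear hy h1 h2
    revert j
    decide
  rw [← h2, ← h1, hj.1]
  generalize superSign 1 j = s at hj
  have hs : s • s • (S.ι y * S.ι x * S.ι x) = S.ι y * S.ι x * S.ι x := by
    rw [smul_smul, hj.2, one_smul]
  simp only [mul_sub, sub_mul, smul_mul_assoc, mul_smul_comm, smul_sub, neg_smul, sq, ← mul_assoc, hs]
  abel

lemma ι_mem_span {n : ℕ} (b : Module.Basis (Fin n) k L) (z : L) :
    S.ι z ∈ Submodule.span k (Set.range fun i => S.ι (b i)) := by
  have h := Submodule.mem_map_of_mem (f := S.ι) (b.mem_span z)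
  rwa [Submodule.map_span, ← Set.range_comp] at h

lemma signCommuting {n : ℕ} (b : Module.Basis (Fin n) k L) {p : Fin n → ZMod 2}
    (hb : ∀ i, b i ∈ S.part (p i)) : SignCommuting k fun i => S.ι (b i) := by
  intro i j
  refine ⟨(-1) ^ ((p i).val * (p j).val), ?_⟩
  have h := S.ι_mul_sub (hb i) (hb j)
  rw [Units.smul_def, Units.val_pow_eq_pow_val, Units.val_neg, Units.val_one]
  exact h ▸ S.ι_mem_span b _

/-- The exponent is 1 for an even generator and 2 for an odd one: in both cases the ordinary
commutator is a bracket or an iterated bracket, hence the image of an element of L. -/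
lemma powerNormalizing {n : ℕ} (b : Module.Basis (Fin n) k L) {p : Fin n → ZMod 2}
    (hb : ∀ i, b i ∈ S.part (p i)) : PowerNormalizing k fun i => S.ι (b i) := by
  intro i
  have hi := hb i
  have hp : p i = 0 ∨ p i = 1 := by
    generalize p i = a
    revert a
    decide
  rcases hp with h | h
  · rw [h] at hi
    refine ⟨1, Nat.one_pos, fun j => ?_⟩
    have h1 := S.ι_mul_sub hi (hb j)
    rw [superSign, ZMod.val_zero, zero_mul, pow_zero, one_smul] at h1
    simp only [pow_one, h1]
    exact S.ι_mem_span b _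
  · rw [h] at hi
    refine ⟨2, Nat.two_pos, fun j => ?_⟩
    simp only [S.ι_sq_mul_sub hi (hb j)]
    exact S.ι_mem_span b _

lemma isWordFiltration {n : ℕ} (b : Module.Basis (Fin n) k L) :
    S.pbwFiltration.IsWordFiltration fun i => S.ι (b i) := by
  set x : Fin n → S.Env := fun i => S.ι (b i)
  intro m
  change (1 ⊔ LinearMap.range S.ι) ^ m = wordSpan k x (m + 1)
  have hnil : (1 : S.Env) ∈ wordSpan k x 1 := wordProd_mem_wordSpan x (l := []) Nat.one_pos
  induction m with
  | zero =>
    rw [pow_zero, Submodule.one_eq_span, wordSpan]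
    congr 1
    ext a
    simp [wordProd]
  | succ m ih =>
    have hle : 1 ⊔ LinearMap.range S.ι ≤ wordSpan k x 2 := by
      refine sup_le ?_ ?_
      · rw [Submodule.one_eq_span, Submodule.span_singleton_le_iff_mem]
        exact wordSpan_mono x one_le_two hnil
      · rintro _ ⟨z, rfl⟩
        exact span_range_le_wordSpan x (S.ι_mem_span b z)
    refine le_antisymm ?_ (Submodule.span_le.2 ?_)
    · rw [pow_succ', ih, show m + 1 + 1 = 1 + (m + 1) by omega]
      exact Submodule.mul_le.2 fun a ha c hc => mul_mem_wordSpan x (hle ha) hc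
    · rintro _ ⟨l, hl, rfl⟩
      cases l with
      | nil =>
        -- The empty word lies in every step, because 1 belongs to the 0th power and the powers
        -- increase.
        exact pow_le_pow_right₀ S.one_le_one_sup (Nat.zero_le _) (Submodule.one_le.1 (pow_zero _).ge)
      | cons i l =>
        rw [wordProd_cons, pow_succ']
        refine Submodule.mul_mem_mul (Submodule.mem_sup_right ⟨b i, rfl⟩) (ih ▸ ?_)
        exact wordProd_mem_wordSpan x (Nat.lt_of_succ_lt_succ hl)

end LieSuperalgebra

theorem mainTheorem4 {k : Type u} [Field k] [IsAlgClosed k] [CharZero k]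
    {L : Type v} [AddCommGroup L] [Module k L] [Module.Finite k L]
    (S : LieSuperalgebra k L) :
    IsCongenial.{u, max u v, w} S.pbwFiltration := by
  obtain ⟨n, b, p, hb⟩ := S.exists_homogeneous_basis
  exact isCongenial_of_isWordFiltration _ (S.isWordFiltration b) (S.signCommuting b hb)
    (S.powerNormalizing b hb)
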